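/- Let $k$ be a commutative ring and let $\mathcal{A}=(A=\bigoplus_{i\in\mathbb{Z}}A^i,d)$ be a differential graded (associative, unital) $k$-algebra such that (P1) $A^i=0$ for $i<0$; (P2) $A^0$ is a semisimple ring; (P3) $d(A^0)=0$. Let $\mathrm{dgHot}(\mathcal{A})$ be the homotopy category of dg right $\mathcal{A}$-modules, with shift $\{1\}$ given by $(\{1\}M)^i=M^{i+1}$, $d_{\{1\}M}=-d_M$, and with the triangulated structure whose distinguished triangles are the triangles isomorphic to mapping cone triangles. Let $\mathrm{dgPer}(\mathcal{A})$ be the smallest full triangulated subcategory of $\mathrm{dgHot}(\mathcal{A})$ that contains $\mathcal{A}$ and is closed under direct summands. Let $\mathrm{dgPrae}(\mathcal{A})$ be the smallest strict (that is, closed under isomorphisms) full triangulated subcategory of $\mathrm{dgHot}(\mathcal{A})$ that contains the dg modules $\hat L=L\otimes_{A^0}\mathcal{A}$ for all simple right $A^0$-modules $L$ (placed in degree $0$). For a dg module $M$ put $A^+=\bigoplus_{i>0}A^i$ and $\overline{M}=M/MA^+=M\otimes_{\mathcal{A}}A^0$, and for $n\in\mathbb{Z}$ let $\mathrm{dgPer}^{\le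 n}$ (respectively $\mathrm{dgPer}^{\ge n}$) be the full subcategory of $\mathrm{dgPer}(\mathcal{A})$ of all objects $M$ with $H^i(\overline{M})=0$ for all $i>n$ (respectively for all $i<n$). Then $\mathrm{dgPrae}(\mathcal{A})=\mathrm{dgPer}(\mathcal{A})$, and $(\mathrm{dgPer}^{\le 0},\mathrm{dgPer}^{\ge 0})$ is a t-structure on $\mathrm{dgPer}(\mathcal{A})$, whose shifted halves are the $\mathrm{dgPer}^{\le n}$ and $\mathrm{dgPer}^{\ge n}$, $n\in\mathbb{Z}$. This t-structure is bounded (every object lies in $\mathrm{dgPer}^{\ge a}\cap\mathrm{dgPer}^{\le b}$ for some $a,b\in\mathbb{Z}$) and in particular non-degenerate (an object that lies in $\mathrm{dgPer}^{\le n}$ for all $n$, or in $\mathrm{dgPer}^{\ge n}$ for all $n$, is zero). -/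

import Mathlib

open CategoryTheory CategoryTheory.Limits CategoryTheory.Pretriangulated
open MulOpposite (op)
open scoped TensorProduct

universe w u

noncomputable section

/-- A differential graded `k`-algebra `(A = ⨁_{i ∈ ℤ} A^i, d)`. -/
structure DGAlgebra (k : Type w) [CommRing k] where
  /-- the underlying algebra `A` -/
  carrier : Type u
  [ring : Ring carrier]
  [algebra : Algebra k carrier]
  /-- the homogeneous components `A^i` -/
  gr : ℤ → Submodule k carrier
  [graded : GradedAlgebra gr]
  /-- the differential -/
  d : carrier →ₗ[k] carrier
  d_mem : ∀ {i : ℤ} {a : carrier}, a ∈ gr i → d a ∈ gr (i + 1)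
  d_d : ∀ a, d (d a) = 0
  leibniz : ∀ {i : ℤ} {a : carrier} (b : carrier), a ∈ gr i →
    d (a * b) = d a * b + i.negOnePow • (a * d b)

namespace DGAlgebra

variable {k : Type w} [CommRing k]

instance : CoeSort (DGAlgebra.{w, u} k) (Type u) := ⟨DGAlgebra.carrier⟩

attribute [instance] DGAlgebra.ring DGAlgebra.algebra DGAlgebra.graded

/-- The underlying graded algebra is positively graded: `A^i = 0` for `i < 0`. -/
def IsPositive (A : DGAlgebra.{w, u} k) : Prop := ∀ i : ℤ, i < 0 → A.gr i = ⊥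

/-- The differential vanishes on `A^0`. -/
def ZeroDiff (A : DGAlgebra.{w, u} k) : Prop := ∀ a ∈ A.gr 0, A.d a = 0

end DGAlgebra

/-- A criterion for a family of subgroups to be an internal direct sum decomposition. -/
theorem isInternal_of_proj {M : Type*} [AddCommGroup M] (gr : ℤ → AddSubgroup M)
    (p : ℤ → M →+ M) (same : ∀ i, ∀ x ∈ gr i, p i x = x)
    (ne : ∀ i j, i ≠ j → ∀ x ∈ gr j, p i x = 0)
    (gen : ∀ x, x ∈ ⨆ i, gr i) : DirectSum.IsInternal gr := by
  classical
  constructor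
  · rw [injective_iff_map_eq_zero]
    intro x hx
    have key : ∀ (y : DirectSum ℤ fun i => gr i) (i : ℤ),
        p i (DirectSum.coeAddMonoidHom gr y) = y i := by
      intro y i
      induction y using DirectSum.induction_on with
      | zero => simp
      | of j y =>
        rw [DirectSum.coeAddMonoidHom_of]
        by_cases h : i = j
        · subst h
          rw [same i _ y.2, DirectSum.of_eq_same]
        · rw [ne i j h _ y.2, DirectSum.of_eq_of_ne _ _ _ h]
          rfl
      | add y z hy hz => simp [hy, hz]
    ext i
    have h := key x i
    rw [hx, map_zero] at h
    simpa using h.symm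
  · intro x
    have hx : x ∈ (DirectSum.coeAddMonoidHom gr).range := by
      refine (iSup_le (fun i y hy => ?_) : ⨆ i, gr i ≤ _) (gen x)
      exact ⟨DirectSum.of (fun i => gr i) i ⟨y, hy⟩, by rw [DirectSum.coeAddMonoidHom_of]⟩
    exact hx

variable {k : Type w} [CommRing k]

/-- A dg (right) module over `A`; a right `A`-module is a module over `Aᵐᵒᵖ`, i.e.
`m · a` is written `op a • m`. -/
structure DGMod (A : DGAlgebra.{w, u} k) where
  /-- the underlying right module `M` -/
  carrier : Type u
  [addCommGroup : AddCommGroup carrier]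
  [module : Module (A : Type u)ᵐᵒᵖ carrier]
  /-- the homogeneous components `M^i` -/
  gr : ℤ → AddSubgroup carrier
  isInternal : DirectSum.IsInternal gr
  smul_mem : ∀ {i j : ℤ} {m : carrier} {a : A}, m ∈ gr i → a ∈ A.gr j → op a • m ∈ gr (i + j)
  /-- the differential -/
  d : carrier →+ carrier
  d_mem : ∀ {i : ℤ} {m : carrier}, m ∈ gr i → d m ∈ gr (i + 1)
  d_d : ∀ m, d (d m) = 0
  leibniz : ∀ {i : ℤ} {m : carrier} (a : A), m ∈ gr i →
    d (op a • m) = op a • d m + i.negOnePow • (op (A.d a) • m)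

namespace DGMod

variable {A : DGAlgebra.{w, u} k}

instance : CoeSort (DGMod A) (Type u) := ⟨DGMod.carrier⟩

attribute [instance] DGMod.addCommGroup DGMod.module

/-- The projection of `M` onto `M^i`. -/
def proj (M : DGMod A) (i : ℤ) : M →+ M :=
  letI := M.isInternal.chooseDecomposition
  (M.gr i).subtype.comp ((DFinsupp.evalAddMonoidHom i).comp
    (DirectSum.decomposeAddEquiv M.gr).toAddMonoidHom)

theorem proj_mem (M : DGMod A) (i : ℤ) (x : M) : M.proj i x ∈ M.gr i :=
  SetLike.coe_mem _

theorem proj_same (M : DGMod A) (i : ℤ) (x : M) (hx : x ∈ M.gr i) : M.proj i x = x :=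
  letI := M.isInternal.chooseDecomposition
  DirectSum.decompose_of_mem_same M.gr hx

theorem proj_ne (M : DGMod A) (i j : ℤ) (h : i ≠ j) (x : M) (hx : x ∈ M.gr j) :
    M.proj i x = 0 :=
  letI := M.isInternal.chooseDecomposition
  DirectSum.decompose_of_mem_ne M.gr hx h.symm

theorem mem_iSup (M : DGMod A) (x : M) : x ∈ ⨆ i, M.gr i := by
  classical
  let _ := M.isInternal.chooseDecomposition
  rw [← DirectSum.sum_support_decompose M.gr x]
  exact AddSubgroup.sum_mem _ fun i _ => (le_iSup M.gr i) (SetLike.coe_mem _)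

/-- Morphisms of dg modules: `A`-linear maps of degree zero commuting with the differentials. -/
@[ext]
structure Hom (M N : DGMod A) where
  /-- the underlying `A`-linear map -/
  lin : M →ₗ[(A : Type u)ᵐᵒᵖ] N
  map_mem : ∀ {i : ℤ} {m : M}, m ∈ M.gr i → lin m ∈ N.gr i
  comm : ∀ m, lin (M.d m) = N.d (lin m)

namespace Hom

variable {M N P : DGMod A}

instance : Zero (Hom M N) := ⟨⟨0, fun _ => by simp, fun _ => by simp⟩⟩

instance : Add (Hom M N) := ⟨fun f g => ⟨f.lin + g.lin,
  fun h => by simpa using add_mem (f.map_mem h) (g.map_mem h),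
  fun m => by simp [f.comm, g.comm]⟩⟩

instance : Neg (Hom M N) := ⟨fun f => ⟨-f.lin,
  fun h => by simpa using f.map_mem h, fun m => by simp [f.comm]⟩⟩

instance : AddCommGroup (Hom M N) where
  add_assoc f g h := Hom.ext (add_assoc _ _ _)
  zero_add f := Hom.ext (zero_add _)
  add_zero f := Hom.ext (add_zero _)
  add_comm f g := Hom.ext (add_comm _ _)
  neg_add_cancel f := Hom.ext (neg_add_cancel _)
  nsmul := nsmulRec
  zsmul := zsmulRec

@[simp] theorem lin_zero : (0 : Hom M N).lin = 0 := rfl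
@[simp] theorem lin_add (f g : Hom M N) : (f + g).lin = f.lin + g.lin := rfl
@[simp] theorem lin_neg (f : Hom M N) : (-f).lin = -f.lin := rfl
@[simp] theorem lin_sub (f g : Hom M N) : (f - g).lin = f.lin - g.lin := by
  rw [sub_eq_add_neg, lin_add, lin_neg, sub_eq_add_neg]

/-- The identity morphism. -/
@[simps] def id (M : DGMod A) : Hom M M := ⟨LinearMap.id, fun h => h, fun _ => rfl⟩

/-- `f.comp g` is `f` followed by `g`. -/
@[simps] def comp (f : Hom M N) (g : Hom N P) : Hom M P :=
  ⟨g.lin.comp f.lin, fun h => g.map_mem (f.map_mem h), fun m => by simp [f.comm, g.comm]⟩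

end Hom

/-- The abelian category `dgMod(A)` of dg modules. -/
instance : Category (DGMod A) where
  Hom := Hom
  id := Hom.id
  comp := Hom.comp

/-- `f` is null-homotopic: `f = d h + h d` for an `A`-linear map `h : M → N` of degree `-1`. -/
def IsNull {M N : DGMod A} (f : Hom M N) : Prop :=
  ∃ h : M →ₗ[(A : Type u)ᵐᵒᵖ] N, (∀ (i : ℤ) (m : M), m ∈ M.gr i → h m ∈ N.gr (i - 1)) ∧
    ∀ m, f.lin m = N.d (h m) + h (M.d m)

theorem IsNull.comp_left {M N P : DGMod A} (f : Hom M N) {g : Hom N P} (hg : IsNull g) :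
    IsNull (f.comp g) := by
  obtain ⟨h, h₁, h₂⟩ := hg
  exact ⟨h.comp f.lin, fun i m hm => h₁ i _ (f.map_mem hm), fun m => by simp [h₂, f.comm]⟩

theorem IsNull.comp_right {M N P : DGMod A} {f : Hom M N} (hf : IsNull f) (g : Hom N P) :
    IsNull (f.comp g) := by
  obtain ⟨h, h₁, h₂⟩ := hf
  exact ⟨g.lin.comp h, fun i m hm => g.map_mem (h₁ i m hm), fun m => by simp [h₂, g.comm]⟩

/-- The subgroup of null-homotopic morphisms. -/
def null (M N : DGMod A) : AddSubgroup (Hom M N) where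
  carrier := {f | IsNull f}
  zero_mem' := ⟨0, fun _ _ _ => by simp, fun _ => by simp⟩
  add_mem' := by
    rintro f g ⟨h, h₁, h₂⟩ ⟨h', h₁', h₂'⟩
    refine ⟨h + h', fun i m hm => add_mem (h₁ i m hm) (h₁' i m hm), fun m => ?_⟩
    simp only [Hom.lin_add, LinearMap.add_apply, h₂, h₂', map_add]
    abel
  neg_mem' := by
    rintro f ⟨h, h₁, h₂⟩
    refine ⟨-h, fun i m hm => neg_mem (h₁ i m hm), fun m => ?_⟩
    simp only [Hom.lin_neg, LinearMap.neg_apply, h₂, map_neg]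
    abel

/-- The shift `{n}M`: `({n}M)^i = M^{i+n}` and `d_{{n}M} = (-1)^n d_M`. -/
abbrev shift (M : DGMod A) (n : ℤ) : DGMod A where
  carrier := M
  gr i := M.gr (i + n)
  isInternal := isInternal_of_proj _ (fun i => M.proj (i + n))
    (fun i => M.proj_same (i + n)) (fun i j h => M.proj_ne _ _ (by omega)) (fun x => by
      have h := M.mem_iSup x
      rwa [← (Equiv.addRight n).iSup_comp] at h)
  smul_mem {i j m a} hm ha := by
    have := M.smul_mem hm ha
    rwa [show i + n + j = i + j + n by ring] at this
  d := n.negOnePow • M.d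
  d_mem {i m} hm := by
    have := M.d_mem hm
    rw [show i + n + 1 = i + 1 + n by ring] at this
    rcases Int.units_eq_one_or n.negOnePow with h | h <;> simpa [h] using this
  d_d m := by simp [M.d_d]
  leibniz {i m} a hm := by
    have := M.leibniz a hm
    simp only [AddMonoidHom.smul_apply, this, smul_add, smul_smul, Int.negOnePow_add]
    congr 1
    · rcases Int.units_eq_one_or n.negOnePow with h | h <;> simp [h]
    · rcases Int.units_eq_one_or n.negOnePow with h | h <;> simp [h]

/-- The identity map `{a}M → {b}M` for `a = b`. -/
def shiftCast (M : DGMod A) {a b : ℤ} (h : a = b) : Hom (M.shift a) (M.shift b) where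
  lin := (LinearMap.id : M →ₗ[(A : Type u)ᵐᵒᵖ] M)
  map_mem {i m} hm := by subst h; exact hm
  comm m := by subst h; rfl

/-- The shift of a morphism. -/
def shiftMap {M N : DGMod A} (f : Hom M N) (n : ℤ) : Hom (M.shift n) (N.shift n) where
  lin := f.lin
  map_mem hm := f.map_mem hm
  comm m := by
    rcases Int.units_eq_one_or n.negOnePow with h | h <;> simp [h, f.comm]

theorem IsNull.shiftMap {M N : DGMod A} {f : Hom M N} (hf : IsNull f) (n : ℤ) :
    IsNull (shiftMap f n) := by
  obtain ⟨h, h₁, h₂⟩ := hf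
  let h' : M →ₗ[(A : Type u)ᵐᵒᵖ] N := n.negOnePow • h
  have hh : ∀ x, h' x = n.negOnePow • h x := fun _ => rfl
  refine ⟨h', fun i m hm => ?_, fun m => ?_⟩
  · have := h₁ _ _ hm
    rw [show i + n - 1 = i - 1 + n by ring] at this
    change h' m ∈ N.gr (i - 1 + n)
    rw [hh]
    rcases Int.units_eq_one_or n.negOnePow with h | h <;> simpa [h] using this
  · change f.lin m = n.negOnePow • N.d (h' m) + h' (n.negOnePow • M.d m)
    rw [hh, hh, h₂]
    rcases Int.units_eq_one_or n.negOnePow with h | h <;> simp [h]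

/-- The isomorphism `{0}M → M`. -/
def shiftZero (M : DGMod A) : Hom (M.shift 0) M where
  lin := (LinearMap.id : M →ₗ[(A : Type u)ᵐᵒᵖ] M)
  map_mem {i m} hm := by simpa using hm
  comm m := by simp

/-- The isomorphism `M → {0}M`. -/
def shiftZeroInv (M : DGMod A) : Hom M (M.shift 0) where
  lin := (LinearMap.id : M →ₗ[(A : Type u)ᵐᵒᵖ] M)
  map_mem {i m} hm := by simpa using hm
  comm m := by simp

/-- The isomorphism `{a+b}M → {b}{a}M`. -/
def shiftAdd (M : DGMod A) (a b : ℤ) : Hom (M.shift (a + b)) ((M.shift a).shift b) where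
  lin := (LinearMap.id : M →ₗ[(A : Type u)ᵐᵒᵖ] M)
  map_mem {i m} hm := by
    change m ∈ M.gr (i + b + a)
    rwa [show i + b + a = i + (a + b) by ring]
  comm m := by
    change (a + b).negOnePow • M.d m = b.negOnePow • (a.negOnePow • M.d m)
    rw [smul_smul, Int.negOnePow_add, mul_comm]

/-- The isomorphism `{b}{a}M → {a+b}M`. -/
def shiftAddInv (M : DGMod A) (a b : ℤ) : Hom ((M.shift a).shift b) (M.shift (a + b)) where
  lin := (LinearMap.id : M →ₗ[(A : Type u)ᵐᵒᵖ] M)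
  map_mem {i m} hm := by
    change m ∈ M.gr (i + (a + b))
    rwa [show i + (a + b) = i + b + a by ring]
  comm m := by
    change b.negOnePow • (a.negOnePow • M.d m) = (a + b).negOnePow • M.d m
    rw [smul_smul, Int.negOnePow_add, mul_comm]

/-- The zero dg module. -/
def zero (A : DGAlgebra.{w, u} k) : DGMod A where
  carrier := PUnit
  gr _ := ⊤
  isInternal := isInternal_of_proj _ (fun _ => 0) (fun _ _ _ => rfl) (fun _ _ _ _ _ => rfl)
    (fun _ => (le_iSup (fun _ : ℤ => (⊤ : AddSubgroup PUnit)) 0) trivial)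
  smul_mem _ _ := trivial
  d := 0
  d_mem _ := trivial
  d_d _ := rfl
  leibniz _ _ := rfl

/-- The mapping cone of `f : M → N`: the graded module `N ⊕ {1}M` with differential
`(n, m) ↦ (d n + f m, - d m)`. -/
abbrev cone {M N : DGMod A} (f : Hom M N) : DGMod A where
  carrier := N × M
  gr i := (N.gr i).prod (M.gr (i + 1))
  isInternal := isInternal_of_proj _ (fun i => (N.proj i).prodMap (M.proj (i + 1)))
    (fun i x hx => Prod.ext (N.proj_same _ _ hx.1) (M.proj_same _ _ hx.2))
    (fun i j h x hx => Prod.ext (N.proj_ne _ _ h _ hx.1) (M.proj_ne _ _ (by omega) _ hx.2))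
    (fun x => by
      have h₁ : ∀ n ∈ ⨆ i, N.gr i, ((n, 0) : N × M) ∈ ⨆ i, (N.gr i).prod (M.gr (i + 1)) := by
        intro n hn
        have h : ⨆ i, N.gr i ≤ (⨆ i, (N.gr i).prod (M.gr (i + 1))).comap
            (AddMonoidHom.inl N M) := iSup_le fun i n hn =>
          (le_iSup (fun i => (N.gr i).prod (M.gr (i + 1))) i) ⟨hn, zero_mem _⟩
        exact h hn
      have h₂ : ∀ m ∈ ⨆ i, M.gr i, ((0, m) : N × M) ∈ ⨆ i, (N.gr i).prod (M.gr (i + 1)) := by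
        intro m hm
        have h : ⨆ i, M.gr i ≤ (⨆ i, (N.gr i).prod (M.gr (i + 1))).comap
            (AddMonoidHom.inr N M) := iSup_le fun i m hm =>
          (le_iSup (fun i => (N.gr i).prod (M.gr (i + 1))) (i - 1))
            ⟨zero_mem _, by simpa using hm⟩
        exact h hm
      have := add_mem (h₁ x.1 (N.mem_iSup _)) (h₂ x.2 (M.mem_iSup _))
      simpa using this)
  smul_mem {i j m a} hm ha := ⟨N.smul_mem hm.1 ha, by
    have := M.smul_mem hm.2 ha
    rwa [show i + 1 + j = i + j + 1 by ring] at this⟩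
  d := (N.d.comp (AddMonoidHom.fst N M) + f.lin.toAddMonoidHom.comp (AddMonoidHom.snd N M)).prod
    (-(M.d.comp (AddMonoidHom.snd N M)))
  d_mem {i m} hm := ⟨add_mem (N.d_mem hm.1) (f.map_mem hm.2),
    (M.gr (i + 1 + 1)).neg_mem (M.d_mem hm.2)⟩
  d_d m := by
    ext <;> simp [N.d_d, M.d_d, f.comm]
  leibniz {i m} a hm := by
    ext
    · simp [N.leibniz a hm.1]
      abel
    · simp [M.leibniz a hm.2, Int.negOnePow_succ]
      abel

/-- The inclusion `N → cone f`. -/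
def coneInl {M N : DGMod A} (f : Hom M N) : Hom N (cone f) where
  lin := LinearMap.inl _ N M
  map_mem hn := ⟨hn, zero_mem _⟩
  comm n := by ext <;> simp

/-- The projection `cone f → {1}M`. -/
def coneSnd {M N : DGMod A} (f : Hom M N) : Hom (cone f) (M.shift 1) where
  lin := LinearMap.snd _ N M
  map_mem hx := hx.2
  comm x := by simp

end DGMod

/-- The homotopy category `dgHot(A)`: its objects are dg modules, its morphisms are morphisms
of dg modules modulo null-homotopic ones. -/
structure DGHot (A : DGAlgebra.{w, u} k) where
  /-- a dg module, viewed as an object of the homotopy category -/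
  of ::
  /-- the underlying dg module -/
  as : DGMod A

namespace DGHot

variable {A : DGAlgebra.{w, u} k}

instance : Category (DGHot A) where
  Hom X Y := DGMod.Hom X.as Y.as ⧸ DGMod.null X.as Y.as
  id X := QuotientAddGroup.mk (DGMod.Hom.id X.as)
  comp {X Y Z} f g := Quotient.liftOn₂' f g (fun f g => QuotientAddGroup.mk (f.comp g)) (by
    intro f g f' g' hf hg
    rw [QuotientAddGroup.leftRel_apply] at hf hg
    refine (QuotientAddGroup.eq).2 ?_
    have := add_mem (show (-f + f').comp g' ∈ DGMod.null X.as Z.as from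
      DGMod.IsNull.comp_right hf g') (show f.comp (-g + g') ∈ DGMod.null X.as Z.as from
      DGMod.IsNull.comp_left f hg)
    convert this using 1
    ext x
    simp only [DGMod.Hom.lin_add, DGMod.Hom.lin_neg, DGMod.Hom.comp_lin, LinearMap.add_apply,
      LinearMap.neg_apply, LinearMap.comp_apply, map_add, map_neg]
    abel)
  id_comp f := by
    induction f using QuotientAddGroup.induction_on with | _ f => rfl
  comp_id f := by
    induction f using QuotientAddGroup.induction_on with | _ f => rfl
  assoc f g h := by
    induction f using QuotientAddGroup.induction_on with | _ f =>
    induction g using QuotientAddGroup.induction_on with | _ g =>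
    induction h using QuotientAddGroup.induction_on with | _ h => rfl

/-- The homotopy class of a morphism of dg modules. -/
def mk {M N : DGMod A} (f : DGMod.Hom M N) : (⟨M⟩ : DGHot A) ⟶ ⟨N⟩ := QuotientAddGroup.mk f

theorem mk_surj {X Y : DGHot A} (f : X ⟶ Y) : ∃ f' : DGMod.Hom X.as Y.as, mk f' = f :=
  QuotientAddGroup.mk_surjective f

instance : Preadditive (DGHot A) where
  homGroup X Y := inferInstanceAs (AddCommGroup (DGMod.Hom X.as Y.as ⧸ DGMod.null X.as Y.as))
  add_comp X Y Z f f' g := by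
    obtain ⟨f, rfl⟩ := mk_surj f
    obtain ⟨f', rfl⟩ := mk_surj f'
    obtain ⟨g, rfl⟩ := mk_surj g
    exact congrArg mk (show (f + f').comp g = f.comp g + f'.comp g by ext x; simp)
  comp_add X Y Z f g g' := by
    obtain ⟨f, rfl⟩ := mk_surj f
    obtain ⟨g, rfl⟩ := mk_surj g
    obtain ⟨g', rfl⟩ := mk_surj g'
    exact congrArg mk (show f.comp (g + g') = f.comp g + f.comp g' by ext x; simp)

section

variable {M N P : DGMod A}

theorem mk_comp (f : DGMod.Hom M N) (g : DGMod.Hom N P) : mk f ≫ mk g = mk (f.comp g) := rfl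
theorem mk_id (M : DGMod A) : 𝟙 (⟨M⟩ : DGHot A) = mk (DGMod.Hom.id M) := rfl
theorem mk_neg (f : DGMod.Hom M N) : -mk f = mk (-f) := rfl
theorem mk_zero : (0 : (⟨M⟩ : DGHot A) ⟶ ⟨N⟩) = mk 0 := rfl
theorem mk_add (f g : DGMod.Hom M N) : mk f + mk g = mk (f + g) := rfl

theorem mk_eq_iff (f g : DGMod.Hom M N) : mk f = mk g ↔ DGMod.IsNull (f - g) := by
  rw [← sub_eq_zero]
  exact QuotientAddGroup.eq_zero_iff (f - g)

theorem mk_eq_of_lin {f g : DGMod.Hom M N} (h : ∀ x, f.lin x = g.lin x) : mk f = mk g :=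
  congrArg mk (DGMod.Hom.ext (LinearMap.ext h))

end

instance : HasZeroObject (DGHot A) := by
  refine ⟨⟨DGMod.zero A⟩, (IsZero.iff_id_eq_zero _).2 ?_⟩
  exact mk_eq_of_lin fun _ => rfl

/-- The shift functor `{n}` on the homotopy category. -/
def shiftF (n : ℤ) : DGHot A ⥤ DGHot A where
  obj X := ⟨X.as.shift n⟩
  map {X Y} f := QuotientAddGroup.map (DGMod.null X.as Y.as)
    (DGMod.null (X.as.shift n) (Y.as.shift n))
    { toFun := fun f => DGMod.shiftMap f n
      map_zero' := rfl
      map_add' := fun _ _ => rfl } (fun f hf => DGMod.IsNull.shiftMap hf n) f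
  map_id X := rfl
  map_comp f g := by
    obtain ⟨f, rfl⟩ := mk_surj f
    obtain ⟨g, rfl⟩ := mk_surj g
    rfl

theorem shiftF_map {M N : DGMod A} (f : DGMod.Hom M N) (n : ℤ) :
    (shiftF n).map (mk f) = mk (DGMod.shiftMap f n) := rfl

theorem eqToHom_shift (X : DGHot A) {a b : ℤ} (h : a = b)
    (h' : (shiftF a).obj X = (shiftF b).obj X) :
    eqToHom h' = mk (DGMod.shiftCast X.as h) := by
  subst h
  rfl

instance : HasShift (DGHot A) ℤ := hasShiftMk _ _
  { F := shiftF
    zero := NatIso.ofComponents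
      (fun X => ⟨mk (DGMod.shiftZero X.as), mk (DGMod.shiftZeroInv X.as), rfl, rfl⟩) (by
        intro X Y f
        obtain ⟨f, rfl⟩ := mk_surj f
        rfl)
    add := fun a b => NatIso.ofComponents
      (fun X => ⟨mk (DGMod.shiftAdd X.as a b), mk (DGMod.shiftAddInv X.as a b), rfl, rfl⟩) (by
        intro X Y f
        obtain ⟨f, rfl⟩ := mk_surj f
        rfl)
    assoc_hom_app := fun a b c X => by
      erw [eqToHom_shift X (add_assoc a b c)]
      rfl
    zero_add_hom_app := fun n X => by
      erw [eqToHom_shift X (zero_add n)]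
      rfl
    add_zero_hom_app := fun n X => by
      erw [eqToHom_shift X (add_zero n)]
      rfl }

theorem shift_map {M N : DGMod A} (f : DGMod.Hom M N) (n : ℤ) :
    (mk f)⟦n⟧' = mk (DGMod.shiftMap f n) := rfl

instance (n : ℤ) : (shiftFunctor (DGHot A) n).Additive where
  map_add {X Y f g} := by
    obtain ⟨f, rfl⟩ := mk_surj f
    obtain ⟨g, rfl⟩ := mk_surj g
    rfl

/-- The standard triangle `M → N → cone f → {1}M` of a morphism `f : M → N` of dg modules. -/
def stdTriangle {M N : DGMod A} (f : DGMod.Hom M N) : Triangle (DGHot A) :=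
  Triangle.mk (mk f) (mk (DGMod.coneInl f)) (mk (DGMod.coneSnd f))

/-- The distinguished triangles are the triangles isomorphic to a standard triangle. -/
def distTriangles (A : DGAlgebra.{w, u} k) : Set (Triangle (DGHot A)) :=
  {T | ∃ (M N : DGMod A) (f : DGMod.Hom M N), Nonempty (T ≅ stdTriangle f)}

theorem isZero_cone_id (M : DGMod A) :
    IsZero (⟨DGMod.cone (DGMod.Hom.id M)⟩ : DGHot A) := by
  rw [IsZero.iff_id_eq_zero, mk_id, mk_zero, mk_eq_iff]
  let h : M × M →ₗ[(A : Type u)ᵐᵒᵖ] M × M :=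
    (LinearMap.inr _ M M).comp (LinearMap.fst _ M M)
  have hh : ∀ x, h x = (0, x.1) := fun _ => rfl
  refine ⟨h, fun i m hm => ⟨zero_mem _, ?_⟩, fun m => ?_⟩
  · have := hm.1
    simpa [hh] using this
  · ext <;> simp [hh]

theorem contractible_mem (X : DGHot A) : contractibleTriangle X ∈ distTriangles A := by
  refine ⟨X.as, X.as, DGMod.Hom.id X.as, ⟨Triangle.isoMk _ _ (Iso.refl _) (Iso.refl _)
    ((isZero_zero _).iso (isZero_cone_id X.as)) ?_ ?_ ?_⟩⟩
  · rfl
  · exact (isZero_cone_id X.as).eq_of_tgt _ _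
  · exact (isZero_zero _).eq_of_src _ _

/-- `{1}M` is homotopy equivalent to the cone of the inclusion `N → cone f`. -/
def rotIso {M N : DGMod A} (f : DGMod.Hom M N) :
    (⟨M.shift 1⟩ : DGHot A) ≅ ⟨DGMod.cone (DGMod.coneInl f)⟩ where
  hom := mk
    { lin := ((LinearMap.inr _ N M).prod (-f.lin) : M →ₗ[(A : Type u)ᵐᵒᵖ] (N × M) × N)
      map_mem := fun hm => ⟨⟨zero_mem _, hm⟩, (N.gr _).neg_mem (f.map_mem hm)⟩
      comm := fun m => by ext <;> simp [DGMod.coneInl, f.comm] }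
  inv := mk
    { lin := ((LinearMap.snd _ N M).comp (LinearMap.fst _ (N × M) N) :
        (N × M) × N →ₗ[(A : Type u)ᵐᵒᵖ] M)
      map_mem := fun hm => hm.1.2
      comm := fun m => by simp [DGMod.coneInl] }
  hom_inv_id := mk_eq_of_lin fun _ => rfl
  inv_hom_id := by
    symm
    rw [mk_id, mk_comp, mk_eq_iff]
    let h : (N × M) × N →ₗ[(A : Type u)ᵐᵒᵖ] (N × M) × N :=
      (LinearMap.inr _ (N × M) N).comp ((LinearMap.fst _ N M).comp (LinearMap.fst _ (N × M) N))
    have hh : ∀ x, h x = (0, x.1.1) := fun _ => rfl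
    refine ⟨h, fun i m hm => ⟨zero_mem _, ?_⟩, fun m => ?_⟩
    · have := hm.1.1
      simpa [hh] using this
    · rw [DGMod.Hom.lin_sub, LinearMap.sub_apply]
      obtain ⟨⟨n, m⟩, n'⟩ := m
      change (((n, m), n') : (N × M) × N) - ((0, m), -f.lin m) =
        ((N.d 0 + f.lin 0 + n, -M.d 0 + 0), -N.d n) + ((0, 0), N.d n + f.lin m + n')
      ext
      · simp
      · simp
      · simp only [Prod.snd_sub, Prod.snd_add]
        abel

theorem rotate_std {M N : DGMod A} (f : DGMod.Hom M N) :
    (stdTriangle f).rotate ∈ distTriangles A := by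
  refine ⟨N, DGMod.cone f, DGMod.coneInl f, ⟨Triangle.isoMk _ _ (Iso.refl _) (Iso.refl _)
    (rotIso f) ?_ ?_ ?_⟩⟩
  · rfl
  · exact (Iso.eq_comp_inv (rotIso f)).1
      (show mk (DGMod.coneSnd f) = mk (DGMod.coneInl (DGMod.coneInl f)) ≫ (rotIso f).inv from rfl)
  · exact mk_eq_of_lin fun _ => rfl

theorem shiftAdd'_inv_app (M : DGMod A) (a b c : ℤ) (h : a + b = c) :
    (shiftFunctorAdd' (DGHot A) a b c h).inv.app ⟨M⟩ =
      mk ((M.shiftAddInv a b).comp (M.shiftCast h)) := by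
  subst h
  rw [shiftFunctorAdd'_eq_shiftFunctorAdd]
  rfl

theorem shiftAdd'_hom_app (M : DGMod A) (a b c : ℤ) (h : a + b = c) :
    (shiftFunctorAdd' (DGHot A) a b c h).hom.app ⟨M⟩ =
      mk ((M.shiftCast h.symm).comp (M.shiftAdd a b)) := by
  subst h
  rw [shiftFunctorAdd'_eq_shiftFunctorAdd]
  rfl

theorem unit_inv_app (M : DGMod A) :
    (shiftEquiv (DGHot A) (1 : ℤ)).unitIso.inv.app ⟨M⟩ =
      mk ((M.shiftAddInv 1 (-1)).comp ((M.shiftCast (by norm_num)).comp M.shiftZero)) := by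
  have h := shiftAdd'_inv_app M 1 (-1) 0 (by norm_num)
  exact congrArg (fun g => g ≫ (shiftFunctorZero (DGHot A) ℤ).hom.app ⟨M⟩) h

theorem counit_inv_app (M : DGMod A) :
    (shiftEquiv (DGHot A) (1 : ℤ)).counitIso.inv.app ⟨M⟩ =
      mk (M.shiftZeroInv.comp ((M.shiftCast (by norm_num)).comp (M.shiftAdd (-1) 1))) := by
  have h := shiftAdd'_hom_app M (-1) 1 0 (by norm_num)
  exact congrArg (fun g => (shiftFunctorZero (DGHot A) ℤ).inv.app ⟨M⟩ ≫ g) h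

/-- A morphism of dg modules representing `{-1} cone f → M`, the shifted third map of the
standard triangle of `f`, up to sign. -/
def invRotMap {M N : DGMod A} (f : DGMod.Hom M N) :
    DGMod.Hom ((DGMod.cone f).shift (-1)) M where
  lin := (-(LinearMap.snd _ N M) : N × M →ₗ[(A : Type u)ᵐᵒᵖ] M)
  map_mem {i m} hm := by
    have := hm.2
    simpa using this
  comm m := by simp

/-- `N` is homotopy equivalent to the cone of `{-1} cone f → M`. -/
def invRotIso {M N : DGMod A} (f : DGMod.Hom M N) :
    (⟨N⟩ : DGHot A) ≅ ⟨DGMod.cone (invRotMap f)⟩ where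
  hom := mk
    { lin := ((LinearMap.inr _ M (N × M)).comp (LinearMap.inl _ N M) :
        N →ₗ[(A : Type u)ᵐᵒᵖ] M × (N × M))
      map_mem := fun {i m} hm => ⟨zero_mem _, by
        change m ∈ N.gr (i + 1 + -1)
        rwa [show i + 1 + -1 = i by ring], zero_mem _⟩
      comm := fun m => by ext <;> simp [invRotMap] }
  inv := mk
    { lin := ((LinearMap.fst _ N M).comp (LinearMap.snd _ M (N × M)) +
        f.lin.comp (LinearMap.fst _ M (N × M)) : M × (N × M) →ₗ[(A : Type u)ᵐᵒᵖ] N)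
      map_mem := fun {i m} hm => add_mem (by
        have : m.2.1 ∈ N.gr (i + 1 + -1) := hm.2.1
        rwa [show i + 1 + -1 = i by ring] at this) (f.map_mem hm.1)
      comm := fun m => by
        simp [invRotMap, f.comm]
        abel }
  hom_inv_id := mk_eq_of_lin fun x => by
    change x + f.lin 0 = x
    simp
  inv_hom_id := by
    symm
    rw [mk_id, mk_comp, mk_eq_iff]
    let h : M × (N × M) →ₗ[(A : Type u)ᵐᵒᵖ] M × (N × M) :=
      (LinearMap.inr _ M (N × M)).comp ((LinearMap.inr _ N M).comp (-(LinearMap.fst _ M (N × M))))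
    have hh : ∀ x, h x = (0, (0, -x.1)) := fun _ => rfl
    refine ⟨h, fun i m hm => ⟨zero_mem _, zero_mem _, ?_⟩, fun m => ?_⟩
    · have := hm.1
      simpa [hh] using this
    · rw [DGMod.Hom.lin_sub, LinearMap.sub_apply]
      obtain ⟨m', n, m⟩ := m
      change ((m', n, m) : M × (N × M)) - (0, n + f.lin m', 0) =
        (DGMod.cone (invRotMap f)).d (0, 0, -m') + (0, 0, -(M.d m' + -m))
      ext <;> simp [invRotMap]

theorem invRotate_std {M N : DGMod A} (f : DGMod.Hom M N) :
    (stdTriangle f).invRotate ∈ distTriangles A := by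
  refine ⟨(DGMod.cone f).shift (-1), M, invRotMap f, ⟨Triangle.isoMk _ _ (Iso.refl _) (Iso.refl _)
    (invRotIso f) ?_ ?_ ?_⟩⟩
  · change (-(shiftFunctor (DGHot A) (-1)).map (mk (DGMod.coneSnd f)) ≫
      (shiftEquiv (DGHot A) (1 : ℤ)).unitIso.inv.app ⟨M⟩) ≫ 𝟙 _ = 𝟙 _ ≫ mk (invRotMap f)
    rw [unit_inv_app, Category.comp_id, Category.id_comp]
    exact mk_eq_of_lin fun _ => rfl
  · exact (Iso.eq_comp_inv (invRotIso f)).1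
      (show mk f = mk (DGMod.coneInl (invRotMap f)) ≫ (invRotIso f).inv from
        mk_eq_of_lin fun x => (zero_add (f.lin x)).symm)
  · change (mk (DGMod.coneInl f) ≫
      (shiftEquiv (DGHot A) (1 : ℤ)).counitIso.inv.app ⟨DGMod.cone f⟩) ≫ _ = _
    rw [counit_inv_app]
    exact mk_eq_of_lin fun _ => rfl

theorem mem_of_iso {T T' : Triangle (DGHot A)} (e : T' ≅ T) (h : T ∈ distTriangles A) :
    T' ∈ distTriangles A := by
  obtain ⟨M, N, f, ⟨e'⟩⟩ := h
  exact ⟨M, N, f, ⟨e ≪≫ e'⟩⟩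

theorem rotate_mem_iff (T : Triangle (DGHot A)) :
    T ∈ distTriangles A ↔ T.rotate ∈ distTriangles A := by
  constructor
  · rintro ⟨M, N, f, ⟨e⟩⟩
    exact mem_of_iso ((rotate (DGHot A)).mapIso e) (rotate_std f)
  · rintro ⟨M, N, f, ⟨e⟩⟩
    exact mem_of_iso (rotCompInvRot.app T ≪≫ (invRotate (DGHot A)).mapIso e) (invRotate_std f)

theorem complete_of_iso {C : Type*} [Category* C] [HasShift C ℤ] {T T' S S' : Triangle C}
    (e : T ≅ S) (e' : T' ≅ S')
    (H : ∀ (a : S.obj₁ ⟶ S'.obj₁) (b : S.obj₂ ⟶ S'.obj₂), S.mor₁ ≫ b = a ≫ S'.mor₁ →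
      ∃ c : S.obj₃ ⟶ S'.obj₃, S.mor₂ ≫ c = b ≫ S'.mor₂ ∧
        S.mor₃ ≫ a⟦(1 : ℤ)⟧' = c ≫ S'.mor₃)
    (a : T.obj₁ ⟶ T'.obj₁) (b : T.obj₂ ⟶ T'.obj₂) (hab : T.mor₁ ≫ b = a ≫ T'.mor₁) :
    ∃ c : T.obj₃ ⟶ T'.obj₃, T.mor₂ ≫ c = b ≫ T'.mor₂ ∧
      T.mor₃ ≫ a⟦(1 : ℤ)⟧' = c ≫ T'.mor₃ := by
  obtain ⟨c, hc₁, hc₂⟩ := H (e.inv.hom₁ ≫ a ≫ e'.hom.hom₁) (e.inv.hom₂ ≫ b ≫ e'.hom.hom₂) (by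
    rw [e.inv.comm₁_assoc, reassoc_of% hab, e'.hom.comm₁, Category.assoc, Category.assoc])
  refine ⟨e.hom.hom₃ ≫ c ≫ e'.inv.hom₃, ?_, ?_⟩
  · rw [e.hom.comm₂_assoc, reassoc_of% hc₁, e'.inv.comm₂]
    simp
  · rw [Category.assoc, Category.assoc, ← e'.inv.comm₃, ← reassoc_of% hc₂, ← e.hom.comm₃_assoc,
      ← Functor.map_comp, ← Functor.map_comp]
    simp

theorem complete_std {M N M' N' : DGMod A} (f : DGMod.Hom M N) (f' : DGMod.Hom M' N')
    (a : (stdTriangle f).obj₁ ⟶ (stdTriangle f').obj₁)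
    (b : (stdTriangle f).obj₂ ⟶ (stdTriangle f').obj₂)
    (hab : (stdTriangle f).mor₁ ≫ b = a ≫ (stdTriangle f').mor₁) :
    ∃ c : (stdTriangle f).obj₃ ⟶ (stdTriangle f').obj₃,
      (stdTriangle f).mor₂ ≫ c = b ≫ (stdTriangle f').mor₂ ∧
      (stdTriangle f).mor₃ ≫ a⟦(1 : ℤ)⟧' = c ≫ (stdTriangle f').mor₃ := by
  obtain ⟨a, rfl⟩ := mk_surj a
  obtain ⟨b, rfl⟩ := mk_surj b
  change DGMod.Hom M M' at a
  change DGMod.Hom N N' at b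
  obtain ⟨s, hs₁, hs₂⟩ := (mk_eq_iff (f.comp b) (a.comp f')).1 hab
  let l : N × M →ₗ[(A : Type u)ᵐᵒᵖ] N' × M' :=
    (b.lin.comp (LinearMap.fst _ N M) + s.comp (LinearMap.snd _ N M)).prod
      (a.lin.comp (LinearMap.snd _ N M))
  have hl : ∀ x, l x = (b.lin x.1 + s x.2, a.lin x.2) := fun _ => rfl
  refine ⟨mk ⟨l, fun {i m} hm => ⟨add_mem (b.map_mem hm.1) ?_, a.map_mem hm.2⟩, fun m => ?_⟩,
    mk_eq_of_lin fun x => ?_, mk_eq_of_lin fun x => rfl⟩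
  · have := hs₁ _ _ hm.2
    simpa using this
  · have h := hs₂ m.2
    simp only [DGMod.Hom.lin_sub, DGMod.Hom.comp_lin, LinearMap.sub_apply,
      LinearMap.comp_apply] at h
    rw [hl, hl]
    ext
    · simp only [AddMonoidHom.prod_apply, AddMonoidHom.add_apply, AddMonoidHom.comp_apply,
        AddMonoidHom.coe_fst, AddMonoidHom.coe_snd, AddMonoidHom.neg_apply, map_add, map_neg,
        LinearMap.toAddMonoidHom_coe, b.comm]
      rw [sub_eq_iff_eq_add.1 h]
      abel
    · simp [a.comm]
  · change l (x, 0) = (b.lin x, 0)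
    simp [hl]

instance : Pretriangulated (DGHot A) where
  distinguishedTriangles := distTriangles A
  isomorphic_distinguished _ h _ e := mem_of_iso e h
  contractible_distinguished := contractible_mem
  distinguished_cocone_triangle {X Y} f := by
    obtain ⟨f, rfl⟩ := mk_surj f
    exact ⟨⟨DGMod.cone f⟩, mk (DGMod.coneInl f), mk (DGMod.coneSnd f), X.as, Y.as, f,
      ⟨Iso.refl _⟩⟩
  rotate_distinguished_triangle := rotate_mem_iff
  complete_distinguished_triangle_morphism := by
    rintro T T' ⟨M, N, f, ⟨e⟩⟩ ⟨M', N', f', ⟨e'⟩⟩ a b hab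
    exact complete_of_iso e e' (complete_std f f') a b hab

end DGHot

namespace DGMod

variable {A : DGAlgebra.{w, u} k}

/-- `A` as a dg module over itself. -/
def self (A : DGAlgebra.{w, u} k) : DGMod A where
  carrier := A
  gr i := (A.gr i).toAddSubgroup
  isInternal := DirectSum.Decomposition.isInternal A.gr
  smul_mem hm ha := SetLike.GradedMul.mul_mem (A := A.gr) hm ha
  d := A.d.toAddMonoidHom
  d_mem hm := A.d_mem hm
  d_d m := A.d_d m
  leibniz a hm := A.leibniz a hm

/-- The endomorphism of `M / S` induced by an additive endomorphism of `M` preserving `S`. -/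
def quotMap {M : DGMod A} (S : Submodule (A : Type u)ᵐᵒᵖ M) (φ : M →+ M)
    (h : ∀ x ∈ S, φ x ∈ S) : M ⧸ S →+ M ⧸ S :=
  QuotientAddGroup.map S.toAddSubgroup S.toAddSubgroup φ h

theorem quotMap_mkQ {M : DGMod A} (S : Submodule (A : Type u)ᵐᵒᵖ M) (φ : M →+ M)
    (h : ∀ x ∈ S, φ x ∈ S) (x : M) : quotMap S φ h (S.mkQ x) = S.mkQ (φ x) := rfl

/-- The quotient of a dg module `M` by a dg submodule, i.e. by a submodule that is graded and
stable under the differential. -/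
abbrev quot (M : DGMod A) (S : Submodule (A : Type u)ᵐᵒᵖ M)
    (hS : ∀ (i : ℤ), ∀ x ∈ S, M.proj i x ∈ S) (hd : ∀ x ∈ S, M.d x ∈ S) : DGMod A where
  carrier := M ⧸ S
  gr i := (M.gr i).map S.mkQ.toAddMonoidHom
  isInternal := isInternal_of_proj _ (fun i => quotMap S (M.proj i) (hS i))
    (by
      rintro i _ ⟨x, hx, rfl⟩
      exact congrArg S.mkQ (M.proj_same i x hx))
    (by
      rintro i j h _ ⟨x, hx, rfl⟩
      exact (congrArg S.mkQ (M.proj_ne i j h x hx)).trans (map_zero _))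
    (fun x => by
      obtain ⟨x, rfl⟩ := S.mkQ_surjective x
      have h := AddSubgroup.mem_map_of_mem S.mkQ.toAddMonoidHom (M.mem_iSup x)
      rwa [AddSubgroup.map_iSup] at h)
  smul_mem := by
    rintro i j _ a ⟨x, hx, rfl⟩ ha
    exact ⟨op a • x, M.smul_mem hx ha, rfl⟩
  d := quotMap S M.d hd
  d_mem := by
    rintro i _ ⟨x, hx, rfl⟩
    exact ⟨M.d x, M.d_mem hx, rfl⟩
  d_d x := by
    obtain ⟨x, rfl⟩ := S.mkQ_surjective x
    exact (congrArg S.mkQ (M.d_d x)).trans (map_zero _)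
  leibniz := by
    rintro i _ a ⟨x, hx, rfl⟩
    exact (congrArg S.mkQ (M.leibniz a hx)).trans (by
      rw [map_add]
      congr 1)

theorem hom_induction (M : DGMod A) {motive : M → Prop} (zero : motive 0)
    (mem : ∀ (i : ℤ), ∀ x ∈ M.gr i, motive x)
    (add : ∀ x y, motive x → motive y → motive (x + y)) (x : M) : motive x := by
  let _ := M.isInternal.chooseDecomposition
  exact DirectSum.Decomposition.inductionOn M.gr zero (fun y => mem _ _ y.2) add x

/-- The subset `M A^+` of `M`, where `A^+ = ⨁_{i > 0} A^i`: the subgroup generated by the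
products `m · a` with `a` homogeneous of positive degree. -/
def mulPosGrp (M : DGMod A) : AddSubgroup M :=
  AddSubgroup.closure {x : M | ∃ (m : M) (j : ℤ) (a : A), 0 < j ∧ a ∈ A.gr j ∧ x = op a • m}

theorem smul_mem_mulPosGrp (M : DGMod A) {j : ℤ} (hj : 0 < j) {a : A} (ha : a ∈ A.gr j) (m : M) :
    op a • m ∈ M.mulPosGrp :=
  AddSubgroup.subset_closure ⟨m, j, a, hj, ha, rfl⟩

theorem map_mem_mulPosGrp (M : DGMod A) (φ : M →+ M)
    (h : ∀ (i j : ℤ) (m : M) (a : A), 0 < j → m ∈ M.gr i → a ∈ A.gr j →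
      φ (op a • m) ∈ M.mulPosGrp) (x : M) (hx : x ∈ M.mulPosGrp) : φ x ∈ M.mulPosGrp := by
  have : M.mulPosGrp ≤ M.mulPosGrp.comap φ := by
    refine (AddSubgroup.closure_le _).2 ?_
    rintro _ ⟨m, j, a, hj, ha, rfl⟩
    change φ (op a • m) ∈ M.mulPosGrp
    refine M.hom_induction (motive := fun m => φ (op a • m) ∈ M.mulPosGrp) ?_
      (fun i m hm => h i j m a hj hm ha) (fun x y hx hy => ?_) m
    · simp [zero_mem]
    · rw [smul_add, map_add]
      exact add_mem hx hy
  exact this hx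

/-- `M A^+` is a submodule of `M` if `A` is positively graded. -/
def mulPos (hA : A.IsPositive) (M : DGMod A) : Submodule (A : Type u)ᵐᵒᵖ M where
  carrier := M.mulPosGrp
  add_mem' := add_mem
  zero_mem' := zero_mem _
  smul_mem' c x hx := by
    refine M.map_mem_mulPosGrp (DistribSMul.toAddMonoidHom M c) (fun i j m a hj hm ha => ?_) x hx
    change c • op a • m ∈ M.mulPosGrp
    obtain ⟨c, rfl⟩ := MulOpposite.op_surjective c
    refine DirectSum.Decomposition.inductionOn A.gr
      (motive := fun c : A => op c • op a • m ∈ M.mulPosGrp) ?_ (fun {l} c => ?_)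
      (fun x y hx hy => ?_) c
    · simp [zero_mem]
    · by_cases hl : l < 0
      · have hc : (c : A) = 0 := (Submodule.mem_bot k).1 ((hA l hl).le c.2)
        simp [hc, zero_mem]
      · rw [smul_smul, ← MulOpposite.op_mul]
        exact M.smul_mem_mulPosGrp (by omega)
          (SetLike.GradedMul.mul_mem (A := A.gr) ha c.2 : a * c ∈ A.gr (j + l)) m
    · rw [MulOpposite.op_add, add_smul]
      exact add_mem hx hy

/-- The dg module `M̄ = M / M A^+ = M ⊗_A A^0`. It is a dg module over `A^0 = A / A^+`, and we
view it as a dg module over `A` along the projection `A → A^0`. -/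
def bar (hA : A.IsPositive) (M : DGMod A) : DGMod A :=
  M.quot (M.mulPos hA)
    (fun i => M.map_mem_mulPosGrp (M.proj i) (fun i' j m a hj hm ha => by
      by_cases h : i = i' + j
      · rw [M.proj_same _ _ (h ▸ M.smul_mem hm ha)]
        exact M.smul_mem_mulPosGrp hj ha m
      · rw [M.proj_ne _ _ h _ (M.smul_mem hm ha)]
        exact zero_mem _))
    (M.map_mem_mulPosGrp M.d (fun i j m a hj hm ha => by
      rw [M.leibniz a hm]
      have h := M.smul_mem_mulPosGrp (show 0 < j + 1 by omega) (A.d_mem ha) m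
      refine add_mem (M.smul_mem_mulPosGrp hj ha _) ?_
      rcases Int.units_eq_one_or i.negOnePow with h' | h' <;> simpa [h'] using h))

/-- The group of `i`-cocycles. -/
def cocycles (M : DGMod A) (i : ℤ) : AddSubgroup M := M.d.ker ⊓ M.gr i

/-- The group of `i`-coboundaries. -/
def coboundaries (M : DGMod A) (i : ℤ) : AddSubgroup M := (M.gr (i - 1)).map M.d

/-- The cohomology `H^i(M)`. -/
def cohomology (M : DGMod A) (i : ℤ) : Type u :=
  M.cocycles i ⧸ (M.coboundaries i).addSubgroupOf (M.cocycles i)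

/-- The support `{i ∈ ℤ | H^i(M) ≠ 0}` of the cohomology of `M`. -/
def suppH (M : DGMod A) : Set ℤ := {i | Nontrivial (M.cohomology i)}

section ExtensionOfScalars

variable (L : Type u) [AddCommGroup L]

/-- The component of degree `i` of `L ⊗_ℤ A`, with `L` in degree zero. -/
def tensGr (A : DGAlgebra.{w, u} k) (i : ℤ) : AddSubgroup ((A : Type u) ⊗[ℤ] L) :=
  AddSubgroup.closure {x | ∃ a ∈ A.gr i, ∃ l : L, x = a ⊗ₜ[ℤ] l}

/-- The projection of `L ⊗_ℤ A` onto the component of degree `i`. -/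
def tensProj (A : DGAlgebra.{w, u} k) (i : ℤ) :
    (A : Type u) ⊗[ℤ] L →+ (A : Type u) ⊗[ℤ] L :=
  (LinearMap.rTensor L (GradedRing.proj A.gr i).toIntLinearMap).toAddMonoidHom

theorem tensProj_same (A : DGAlgebra.{w, u} k) (i : ℤ) (x : (A : Type u) ⊗[ℤ] L)
    (hx : x ∈ tensGr L A i) : tensProj L A i x = x := by
  induction hx using AddSubgroup.closure_induction with
  | zero => rw [map_zero]
  | neg x _ h => rw [map_neg, h]
  | add x y _ _ hx hy => rw [map_add, hx, hy]
  | mem x h =>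
    obtain ⟨a, ha, l, rfl⟩ := h
    exact congrArg (· ⊗ₜ[ℤ] l) (DirectSum.decompose_of_mem_same A.gr ha)

theorem tensProj_ne (A : DGAlgebra.{w, u} k) (i j : ℤ) (h : i ≠ j) (x : (A : Type u) ⊗[ℤ] L)
    (hx : x ∈ tensGr L A j) : tensProj L A i x = 0 := by
  induction hx using AddSubgroup.closure_induction with
  | zero => rw [map_zero]
  | neg x _ h => rw [map_neg, h, neg_zero]
  | add x y _ _ hx hy => rw [map_add, hx, hy, add_zero]
  | mem x h' =>
    obtain ⟨a, ha, l, rfl⟩ := h'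
    exact (congrArg (· ⊗ₜ[ℤ] l) (DirectSum.decompose_of_mem_ne A.gr ha h.symm)).trans
      (TensorProduct.zero_tmul _ _)

theorem mem_iSup_tensGr (A : DGAlgebra.{w, u} k) (x : (A : Type u) ⊗[ℤ] L) :
    x ∈ ⨆ i, tensGr L A i := by
  induction x using TensorProduct.induction_on with
  | zero => exact zero_mem _
  | add x y hx hy => exact add_mem hx hy
  | tmul a l =>
    refine DirectSum.Decomposition.inductionOn A.gr
      (motive := fun a : A => a ⊗ₜ[ℤ] l ∈ ⨆ i, tensGr L A i) ?_ (fun {i} a => ?_)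
      (fun a b ha hb => ?_) a
    · rw [TensorProduct.zero_tmul]
      exact zero_mem _
    · exact (le_iSup (tensGr L A) i) (AddSubgroup.subset_closure ⟨a, a.2, l, rfl⟩)
    · rw [TensorProduct.add_tmul]
      exact add_mem ha hb

/-- The dg module `L ⊗_ℤ A`, with `L` in degree zero and differential `id ⊗ d`. The factors are
written in the opposite order, since right multiplication by `A` acts on the factor `A`. -/
abbrev tens (A : DGAlgebra.{w, u} k) : DGMod A where
  carrier := (A : Type u) ⊗[ℤ] L
  gr i := tensGr L A i
  isInternal := isInternal_of_proj _ (tensProj L A) (tensProj_same L A) (tensProj_ne L A)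
    (mem_iSup_tensGr L A)
  smul_mem {i j x b} hx hb := by
    induction hx using AddSubgroup.closure_induction with
    | zero => rw [smul_zero]; exact zero_mem _
    | neg x _ h => rw [smul_neg]; exact neg_mem h
    | add x y _ _ hx hy => rw [smul_add]; exact add_mem hx hy
    | mem x h =>
      obtain ⟨a, ha, l, rfl⟩ := h
      exact AddSubgroup.subset_closure
        ⟨a * b, SetLike.GradedMul.mul_mem (A := A.gr) ha hb, l, rfl⟩
  d := (LinearMap.rTensor L A.d.toAddMonoidHom.toIntLinearMap).toAddMonoidHom
  d_mem {i x} hx := by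
    induction hx using AddSubgroup.closure_induction with
    | zero => rw [map_zero]; exact zero_mem _
    | neg x _ h => rw [map_neg]; exact neg_mem h
    | add x y _ _ hx hy => rw [map_add]; exact add_mem hx hy
    | mem x h =>
      obtain ⟨a, ha, l, rfl⟩ := h
      exact AddSubgroup.subset_closure ⟨A.d a, A.d_mem ha, l, rfl⟩
  d_d x := by
    induction x using TensorProduct.induction_on with
    | zero => simp
    | add x y hx hy => rw [map_add, map_add, hx, hy, add_zero]
    | tmul a l => exact (congrArg (· ⊗ₜ[ℤ] l) (A.d_d a)).trans (TensorProduct.zero_tmul _ _)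
  leibniz {i x} b hx := by
    induction hx using AddSubgroup.closure_induction with
    | zero => simp
    | neg x _ h => simp only [smul_neg, map_neg, h, neg_add]
    | add x y _ _ hx hy =>
      simp only [smul_add, map_add, hx, hy]
      abel
    | mem x h =>
      obtain ⟨a, ha, l, rfl⟩ := h
      refine (congrArg (· ⊗ₜ[ℤ] l) (A.leibniz b ha)).trans ?_
      change (A.d a * b + i.negOnePow • (a * A.d b)) ⊗ₜ[ℤ] l =
        (A.d a * b) ⊗ₜ[ℤ] l + i.negOnePow • ((a * A.d b) ⊗ₜ[ℤ] l)
      rw [TensorProduct.add_tmul]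
      rcases Int.units_eq_one_or i.negOnePow with h | h <;> simp [h, TensorProduct.neg_tmul]

variable [Module (A.gr 0)ᵐᵒᵖ L]

/-- The subgroup of `L ⊗_ℤ A` generated by the elements `l ⊗ a₀ a - l a₀ ⊗ a` with `a₀ ∈ A^0`. -/
def relGrp (A : DGAlgebra.{w, u} k) [Module (A.gr 0)ᵐᵒᵖ L] : AddSubgroup (tens L A) :=
  AddSubgroup.closure {x | ∃ (a₀ : A.gr 0) (a : A) (l : L),
    x = ((a₀ : A) * a) ⊗ₜ[ℤ] l - a ⊗ₜ[ℤ] (op a₀ • l)}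

theorem map_mem_relGrp (φ : A →+ A)
    (h : ∀ (a₀ : A.gr 0) (a : A), φ ((a₀ : A) * a) = (a₀ : A) * φ a) (x : tens L A)
    (hx : x ∈ relGrp L A) :
    LinearMap.rTensor L φ.toIntLinearMap x ∈ relGrp L A := by
  induction hx using AddSubgroup.closure_induction with
  | zero => rw [map_zero]; exact zero_mem _
  | neg x _ h => rw [map_neg]; exact neg_mem h
  | add x y _ _ hx hy => rw [map_add]; exact add_mem hx hy
  | mem x hx =>
    obtain ⟨a₀, a, l, rfl⟩ := hx
    refine AddSubgroup.subset_closure ⟨a₀, φ a, l, ?_⟩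
    rw [map_sub, ← h]
    rfl

/-- The same subgroup as a submodule. -/
def rel (A : DGAlgebra.{w, u} k) [Module (A.gr 0)ᵐᵒᵖ L] :
    Submodule (A : Type u)ᵐᵒᵖ (tens L A) where
  carrier := relGrp L A
  add_mem' := add_mem
  zero_mem' := zero_mem _
  smul_mem' c x hx := by
    have h := map_mem_relGrp L (DistribSMul.toAddMonoidHom (A : Type u) c)
      (fun a₀ a => (mul_smul_comm c (a₀ : A) a).symm ▸ rfl) x hx
    have : LinearMap.rTensor L (DistribSMul.toAddMonoidHom (A : Type u) c).toIntLinearMap x =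
        c • x := by
      clear h hx
      induction x using TensorProduct.induction_on with
      | zero => simp
      | add x y hx hy => rw [map_add, hx, hy, smul_add]
      | tmul a l => rfl
    exact this ▸ h

/-- The dg module `L̂ = L ⊗_{A^0} A` for a right `A^0`-module `L` (viewed as a dg module over
`A^0` in degree zero), where the differential of `A` vanishes on `A^0`. Its differential is
`l ⊗ a ↦ l ⊗ d a`, and `l ⊗ a` has the degree of `a`. -/
def hat (hA : A.ZeroDiff) : DGMod A :=
  (tens L A).quot (rel L A)
    (fun i x hx => by
      have h : (tens L A).proj i x = tensProj L A i x := by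
        refine (tens L A).hom_induction (motive := fun x => (tens L A).proj i x = tensProj L A i x)
          ?_ (fun j x hx => ?_) (fun x y hx hy => ?_) x
        · rw [map_zero, map_zero]
        · by_cases h : i = j
          · subst h
            rw [proj_same _ _ _ hx, tensProj_same L A _ _ hx]
          · rw [proj_ne _ _ _ h _ hx, tensProj_ne L A _ _ h _ hx]
        · rw [map_add, map_add, hx, hy]
      rw [h]
      exact map_mem_relGrp L (GradedRing.proj A.gr i) (fun a₀ a =>
        DirectSum.coe_decompose_mul_of_left_mem_zero A.gr a₀.2) x hx)
    (fun x hx => map_mem_relGrp L A.d.toAddMonoidHom (fun a₀ a => by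
      have h := A.leibniz a a₀.2
      rw [hA _ a₀.2] at h
      simpa using h) x hx)

end ExtensionOfScalars

end DGMod

namespace DGHot

variable (A : DGAlgebra.{w, u} k)

/-- `dgPer(A)`, the perfect dg modules: the smallest full triangulated subcategory of `dgHot(A)`
that contains `A` and is closed under direct summands (that is, under retracts). -/
def dgPer : ObjectProperty (DGHot A) := fun X =>
  ∀ P : ObjectProperty (DGHot A), P.IsTriangulated → P.IsStableUnderRetracts →
    P ⟨DGMod.self A⟩ → P X

instance : (dgPer A).IsStableUnderRetracts where
  of_retract r h P hP hR hA := P.prop_of_retract r (h P hP hR hA)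

instance : (dgPer A).IsTriangulated where
  exists_zero := by
    obtain ⟨Z, hZ⟩ := HasZeroObject.zero (C := DGHot A)
    exact ⟨Z, hZ, fun P hP hR _ => P.prop_of_isZero hZ⟩
  isStableUnderShiftBy n := ⟨fun X h P hP hR hA => P.le_shift n X (h P hP hR hA)⟩
  ext₂' T hT h₁ h₃ := ObjectProperty.le_isoClosure _ _ fun P hP hR hA =>
    P.ext_of_isTriangulatedClosed₂ T hT (h₁ P hP hR hA) (h₃ P hP hR hA)

variable {A}

/-- `dgPrae(A)`: the smallest strict (i.e. closed under isomorphisms) full triangulated subcategory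
of `dgHot(A)` that contains `L̂` for all simple right `A^0`-modules `L`. -/
def dgPrae (hA : A.ZeroDiff) : ObjectProperty (DGHot A) := fun X =>
  ∀ P : ObjectProperty (DGHot A), P.IsTriangulated → P.IsClosedUnderIsomorphisms →
    (∀ (L : Type u) [AddCommGroup L] [Module (A.gr 0)ᵐᵒᵖ L] [IsSimpleModule (A.gr 0)ᵐᵒᵖ L],
      P ⟨DGMod.hat L hA⟩) → P X

/-- `dgPer^I(A)`, for `I ⊆ ℤ`: the full subcategory of `dgPer(A)` of all objects `M` such that
the support of `H(M̄) = H(M ⊗_A A^0)` is contained in `I`. -/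
def dgPerSupp (hA : A.IsPositive) (I : Set ℤ) : ObjectProperty (dgPer A).FullSubcategory :=
  fun X => (X.obj.as.bar hA).suppH ⊆ I

end DGHot

/-- A t-structure is bounded if every object is bounded above and below. -/
def IsBoundedTStructure {C : Type*} [Category* C] [Preadditive C] [HasZeroObject C]
    [HasShift C ℤ] [∀ n : ℤ, (shiftFunctor C n).Additive] [Pretriangulated C]
    (t : Triangulated.TStructure C) : Prop :=
  ∀ X : C, ∃ a b : ℤ, t.ge a X ∧ t.le b X

/-- A t-structure is non-degenerate if the objects that lie in `C^{≤ n}` for all `n` are zero,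
and so are the objects that lie in `C^{≥ n}` for all `n`. -/
def IsNondegenerateTStructure {C : Type*} [Category* C] [Preadditive C] [HasZeroObject C]
    [HasShift C ℤ] [∀ n : ℤ, (shiftFunctor C n).Additive] [Pretriangulated C]
    (t : Triangulated.TStructure C) : Prop :=
  (∀ X : C, (∀ n : ℤ, t.le n X) → IsZero X) ∧ (∀ X : C, (∀ n : ℤ, t.ge n X) → IsZero X)

end

/-! Both `dgPrae` and `dgPer` turn out to be the class of finite iterated extensions of shifts of
the modules `L̂`, `L` simple, and the t-structure is read off from these extensions.

Three facts about `L̂` carry everything. It is generated by the elements `l ⊗ 1` of degree zero and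
has nothing in negative degrees, so `Hom(L̂, L̂₁[-n]) = 0` for `n > 0`. Its part of degree zero is
`L`, so Schur's lemma makes every nonzero map between such modules invertible. Finally `H(L̂ ⊗_A
A^0)` is `L` in degree zero.

The first two facts say that the `L̂` form a simple-minded class (`IsSimpleMinded`). An iterated
extension is recorded by the word of the degrees of its factors. Two adjacent factors in decreasing
degree can be exchanged: the connecting map either vanishes, and the extension splits, or is
invertible, and both factors cancel (`extensionProduct_shift_swap`). Hence words can be sorted.
Cutting a word at `n` gives truncation triangles, and factors of smaller degree have no maps to
factors of larger degree, which gives orthogonality.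

For sorted words, an induction on the length shows that a retract of an iterated extension is again
one (`words_of_retract`). So the triangulated subcategory generated by the `L̂` is already closed
under summands. It contains `A`, which is `L̂` for the finite length module `L = A^0`; conversely
every simple `L` is a summand of `A^0`, so `L̂` is a summand of `A`. This gives `dgPrae = dgPer`.

The third fact, with the long exact sequence for `M ↦ H(M̄)`, shows that vanishing of all `H^i(M̄)`
detects zero among these objects (`isZero_of_words`). Applied to the pieces of a truncation
triangle, this identifies the halves given by words with those given by the cohomology of `M̄`;
boundedness is finiteness of a word, and non-degeneracy is detection. -/

noncomputable section

variable {k : Type w} [CommRing k]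

/-! ### Octahedra in `dgHot(A)` -/

namespace DGHot

variable {A : DGAlgebra.{w, u} k} {M N P : DGMod A}

/-- The morphism `cone f → cone (g ∘ f)` induced by `g`. -/
def coneMapRight (f : DGMod.Hom M N) (g : DGMod.Hom N P) :
    DGMod.Hom (DGMod.cone f) (DGMod.cone (f.comp g)) where
  lin := (g.lin.comp (LinearMap.fst _ N M)).prod (LinearMap.snd _ N M)
  map_mem hx := ⟨g.map_mem hx.1, hx.2⟩
  comm x := by ext <;> simp [g.comm]

/-- The morphism `cone (g ∘ f) → cone g` induced by `f`. -/
def coneMapLeft (f : DGMod.Hom M N) (g : DGMod.Hom N P) :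
    DGMod.Hom (DGMod.cone (f.comp g)) (DGMod.cone g) where
  lin := (LinearMap.fst _ P M).prod (f.lin.comp (LinearMap.snd _ P M))
  map_mem hx := ⟨hx.1, f.map_mem hx.2⟩
  comm x := by ext <;> simp [f.comm]

/-- `cone g` is homotopy equivalent to the cone of `cone f → cone (g ∘ f)`. -/
def octahedronIso (f : DGMod.Hom M N) (g : DGMod.Hom N P) :
    (⟨DGMod.cone g⟩ : DGHot A) ≅ ⟨DGMod.cone (coneMapRight f g)⟩ where
  hom := mk
    { lin := ((LinearMap.inl _ P M).comp (LinearMap.fst _ P N)).prod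
        ((LinearMap.inl _ N M).comp (LinearMap.snd _ P N))
      map_mem := fun hx => ⟨⟨hx.1, zero_mem _⟩, ⟨hx.2, zero_mem _⟩⟩
      comm := fun x => by ext <;> simp [coneMapRight] }
  inv := mk
    { lin := (((LinearMap.fst _ P M).comp (LinearMap.fst _ (P × M) (N × M))).prod
        ((LinearMap.fst (A : Type u)ᵐᵒᵖ N M).comp (LinearMap.snd _ (P × M) (N × M)) +
          f.lin.comp ((LinearMap.snd _ P M).comp (LinearMap.fst _ (P × M) (N × M)))) :
        (P × M) × (N × M) →ₗ[(A : Type u)ᵐᵒᵖ] P × N)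
      map_mem := fun hx => ⟨hx.1.1, (N.gr _).add_mem hx.2.1 (f.map_mem hx.1.2)⟩
      comm := fun x => by
        ext
        · simp [coneMapRight]
          abel
        · simp [coneMapRight, f.comm]
          abel }
  hom_inv_id := mk_eq_of_lin fun x => by
    change ((x.1, x.2 + f.lin 0) : P × N) = x
    simp
  inv_hom_id := by
    symm
    rw [mk_id, mk_comp, mk_eq_iff]
    -- The cone contains `M` twice, joined by the identity; `h` carries the copy in `cone (g ∘ f)`
    -- to the one in `cone f` and so contracts the pair.
    let h : (P × M) × (N × M) →ₗ[(A : Type u)ᵐᵒᵖ] (P × M) × (N × M) :=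
      (LinearMap.inr _ (P × M) (N × M)).comp ((LinearMap.inr _ N M).comp
        ((LinearMap.snd _ P M).comp (LinearMap.fst _ (P × M) (N × M))))
    have hh : ∀ x, h x = ((0, 0), (0, x.1.2)) := fun _ => rfl
    refine ⟨h, fun i x hx => ⟨⟨zero_mem _, zero_mem _⟩, ⟨zero_mem _, ?_⟩⟩, fun x => ?_⟩
    · have := hx.1.2
      simpa [hh] using this
    · rw [DGMod.Hom.lin_sub, LinearMap.sub_apply]
      obtain ⟨⟨p, m⟩, n, m'⟩ := x
      change (((p, m), (n, m')) : (P × M) × (N × M)) - ((p, 0), (n + f.lin m, 0)) =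
        (DGMod.cone (coneMapRight f g)).d ((0, 0), (0, m)) + ((0, 0), (0, -M.d m + m'))
      ext <;> simp [coneMapRight]

/-- Octahedra are needed only up to isomorphism, so honest representatives and strict cones suffice.
The squares then commute before passing to homotopy, and `octahedronIso` makes the remaining
triangle distinguished. -/
instance : IsTriangulated (DGHot A) := IsTriangulated.mk' (by
  intro X₁ X₂ X₃ u₁₂ u₂₃
  obtain ⟨f, rfl⟩ := mk_surj u₁₂
  obtain ⟨g, rfl⟩ := mk_surj u₂₃
  refine ⟨X₁, X₂, X₃, ⟨DGMod.cone f⟩, ⟨DGMod.cone g⟩, ⟨DGMod.cone (f.comp g)⟩, mk f, mk g,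
    Iso.refl _, Iso.refl _, Iso.refl _, by rfl, by rfl,
    mk (DGMod.coneInl f), mk (DGMod.coneSnd f), ⟨X₁.as, X₂.as, f, ⟨Iso.refl _⟩⟩,
    mk (DGMod.coneInl g), mk (DGMod.coneSnd g), ⟨X₂.as, X₃.as, g, ⟨Iso.refl _⟩⟩,
    mk (DGMod.coneInl (f.comp g)), mk (DGMod.coneSnd (f.comp g)),
    ⟨X₁.as, X₃.as, f.comp g, ⟨Iso.refl _⟩⟩, ⟨⟨mk (coneMapRight f g), mk (coneMapLeft f g),
      mk_eq_of_lin fun _ => rfl, mk_eq_of_lin fun _ => rfl, mk_eq_of_lin fun x => ?_,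
      mk_eq_of_lin fun _ => rfl, ?_⟩⟩⟩
  · change ((x, f.lin 0) : X₃.as × X₂.as) = (x, 0)
    simp
  · refine ⟨_, _, coneMapRight f g, ⟨Triangle.isoMk _ _ (Iso.refl _) (Iso.refl _)
      (octahedronIso f g) rfl ?_ ?_⟩⟩
    · exact (Iso.eq_comp_inv (octahedronIso f g)).1 (mk_eq_of_lin fun x => by
        change ((x.1, f.lin x.2) : X₃.as × X₂.as) = (x.1, 0 + f.lin x.2)
        rw [zero_add])
    · exact mk_eq_of_lin fun _ => rfl)

end DGHot

/-! ### Iterated extensions of shifts of a simple-minded class of objects -/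

namespace CategoryTheory.ObjectProperty

variable {C : Type*} [Category* C] [HasShift C ℤ]
  [Preadditive C] [∀ (n : ℤ), (shiftFunctor C n).Additive]

/-- A class of objects which is closed under isomorphisms, contains zero, has no negative
self-extensions, and in which all nonzero morphisms are invertible. -/
class IsSimpleMinded (P : ObjectProperty C) : Prop extends
    P.IsClosedUnderIsomorphisms where
  zero_mem {X : C} : IsZero X → P X
  hom_eq_zero {X Y : C} (f : X ⟶ Y) {n : ℤ} : 0 < n → P X → P.shift n Y → f = 0
  isIso {X Y : C} (f : X ⟶ Y) : P X → P Y → f ≠ 0 → IsIso f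

variable (P : ObjectProperty C)

theorem shift_of_isZero [P.IsSimpleMinded] (a : ℤ) {X : C} (hX : IsZero X) : P.shift a X :=
  IsSimpleMinded.zero_mem (P := P) ((shiftFunctor C a).map_isZero hX)

/-- Since `P.shift a X` means `P (X⟦a⟧)`, an object of `P.shift a` is to be thought of as sitting in
degree `a`. Shifting by `a` reduces the claim to the axiom. -/
theorem hom_eq_zero_of_shift [P.IsSimpleMinded] {X Y : C} (f : X ⟶ Y) {a b : ℤ} (hab : a < b)
    (hX : P.shift a X) (hY : P.shift b Y) : f = 0 := by
  apply (shiftFunctor C a).map_injective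
  rw [Functor.map_zero]
  refine IsSimpleMinded.hom_eq_zero (P := P) _ (sub_pos.2 hab) hX ?_
  change (P.shift (b - a)).shift a Y
  rwa [P.shift_shift a (b - a) b (by ring)]

theorem isIso_of_shift [P.IsSimpleMinded] {X Y : C} (f : X ⟶ Y) {a : ℤ}
    (hX : P.shift a X) (hY : P.shift a Y) (hf : f ≠ 0) : IsIso f := by
  have : IsIso (f⟦a⟧') := IsSimpleMinded.isIso (P := P) _ hX hY fun h =>
    hf ((shiftFunctor C a).map_injective (by rw [h, Functor.map_zero]))
  exact isIso_of_reflects_iso f (shiftFunctor C a)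

variable [HasZeroObject C] [Pretriangulated C]

/-- `P.word [a₁, …, aₙ]` is the class of iterated extensions `P[-a₁] * ⋯ * P[-aₙ]`. -/
def word : List ℤ → ObjectProperty C
  | [] => fun X => IsZero X
  | a :: l => extensionProduct (P.shift a) (word l)

/-- The objects that are iterated extensions of shifts of objects of `P`. -/
def words : ObjectProperty C := fun X => ∃ l, P.word l X

instance word_isClosedUnderIsomorphisms (l : List ℤ) : (P.word l).IsClosedUnderIsomorphisms := by
  cases l with
  | nil => exact ⟨fun e h => h.of_iso e.symm⟩
  | cons a l =>
    exact inferInstanceAs (extensionProduct (P.shift a) (P.word l)).IsClosedUnderIsomorphisms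

instance words_isClosedUnderIsomorphisms : P.words.IsClosedUnderIsomorphisms :=
  ⟨fun e ⟨l, h⟩ => ⟨l, (P.word l).prop_of_iso e h⟩⟩

theorem extensionProduct_of_isZero {P Q : ObjectProperty C} {X : C} (hX : IsZero X)
    (hP : P X) (hQ : Q X) : extensionProduct P Q X :=
  ⟨X, X, 0, 0, 0, isomorphic_distinguished _ (contractible_distinguished X) _
    (Triangle.isoMk _ _ (Iso.refl _) (Iso.refl _) (hX.iso (isZero_zero C))
      (hX.eq_of_src _ _) (hX.eq_of_src _ _) (hX.eq_of_src _ _)), hP, hQ⟩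

theorem extensionProduct_isZero_left (Q : ObjectProperty C) [Q.IsClosedUnderIsomorphisms] :
    extensionProduct (fun X : C => IsZero X) Q = Q := by
  refine le_antisymm ?_ fun X hX => ?_
  · rintro X ⟨Y, Z, f, g, h, hT, hY, hZ⟩
    have : IsIso g := (Triangle.isZero₁_iff_isIso₂ _ hT).1 hY
    exact Q.prop_of_iso (asIso g).symm hZ
  · exact ⟨_, _, _, _, _, contractible_distinguished₁ X, isZero_zero C, hX⟩

theorem extensionProduct_isZero_right (Q : ObjectProperty C) [Q.IsClosedUnderIsomorphisms] :
    extensionProduct Q (fun X : C => IsZero X) = Q := by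
  refine le_antisymm ?_ fun X hX => ?_
  · rintro X ⟨Y, Z, f, g, h, hT, hY, hZ⟩
    have : IsIso f := (Triangle.isZero₃_iff_isIso₁ _ hT).1 hZ
    exact Q.prop_of_iso (asIso f) hY
  · exact ⟨_, _, _, _, _, contractible_distinguished X, hX, isZero_zero C⟩

/-- Associativity of the extension product, hence the octahedral axiom; this is what closes `words`
under extensions. -/
theorem word_append [IsTriangulated C] (l l' : List ℤ) :
    P.word (l ++ l') = extensionProduct (P.word l) (P.word l') := by
  induction l with
  | nil => exact (extensionProduct_isZero_left _).symm
  | cons a l ih =>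
    change extensionProduct _ (P.word (l ++ l')) = extensionProduct (extensionProduct _ _) _
    rw [ih, extensionProduct_assoc]

theorem word_singleton [P.IsClosedUnderIsomorphisms] (a : ℤ) : P.word [a] = P.shift a :=
  extensionProduct_isZero_right _

theorem le_words [P.IsClosedUnderIsomorphisms] : P ≤ P.words := fun X hX => ⟨[0], by
  rwa [word_singleton, P.shift_zero]⟩

/-- The minimality half of the claim that `words` is the triangulated subcategory generated by a
simple-minded `P`. -/
theorem words_le {Q : ObjectProperty C} [Q.IsTriangulated] [Q.IsClosedUnderIsomorphisms]
    (h : P ≤ Q) : P.words ≤ Q := by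
  rintro X ⟨l, hX⟩
  induction l generalizing X with
  | nil => exact Q.prop_of_isZero hX
  | cons a l ih =>
    obtain ⟨Y, Z, _, _, _, hT, hY, hZ⟩ := hX
    exact Q.ext_of_isTriangulatedClosed₂ _ hT
      ((Q.prop_shift_iff_of_isStableUnderShift _ a).1 (h _ hY)) (ih Z hZ)

theorem extensionProduct_shift {P Q P' Q' : ObjectProperty C} (a : ℤ) (hP : P ≤ P'.shift a)
    (hQ : Q ≤ Q'.shift a) : extensionProduct P Q ≤ (extensionProduct P' Q').shift a := by
  rintro X ⟨Y, Z, f, g, h, hT, hY, hZ⟩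
  exact ⟨_, _, _, _, _, Triangle.shift_distinguished _ hT a, hP _ hY, hQ _ hZ⟩

theorem word_le_shift [P.IsClosedUnderIsomorphisms] (a : ℤ) (l : List ℤ) :
    P.word l ≤ (P.word (l.map (· - a))).shift a := by
  induction l with
  | nil => exact fun X hX => (shiftFunctor C a).map_isZero hX
  | cons b l ih =>
    refine extensionProduct_shift a ?_ ih
    rw [P.shift_shift a (b - a) b (by ring)]

/-- The triangle splits, and a biproduct is an extension in either order. -/
theorem extensionProduct_of_mor₃_eq_zero {P Q : ObjectProperty C} {X Y Z : C} {f : Y ⟶ X}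
    {g : X ⟶ Z} (hT : Triangle.mk f g 0 ∈ distTriang C) (hY : P Y) (hZ : Q Z) :
    extensionProduct Q P X := by
  obtain ⟨e, -, -⟩ := exists_iso_binaryBiproduct_of_distTriang _ hT rfl
  exact prop_of_iso _ ((biprod.braiding Z Y) ≪≫ e.symm)
    ⟨_, _, _, _, _, binaryBiproductTriangle_distinguished Z Y, hZ, hY⟩

/-- The connecting map goes from degree `b` to degree `a - 1 ≥ b`. If it is zero, the extension
splits. Otherwise `b = a - 1` and the map is invertible, so the extension is zero and lies in
everything. -/
theorem extensionProduct_shift_swap [P.IsSimpleMinded] {a b : ℤ} (hab : b < a) :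
    extensionProduct (P.shift a) (P.shift b) ≤ extensionProduct (P.shift b) (P.shift a) := by
  rintro X ⟨Y, Z, f, g, h, hT, hY, hZ⟩
  have hY' : P.shift (a - 1) (Y⟦(1 : ℤ)⟧) := by
    change (P.shift (a - 1)).shift 1 Y
    rwa [P.shift_shift 1 (a - 1) a (by ring)]
  by_cases h0 : h = 0
  · subst h0
    exact extensionProduct_of_mor₃_eq_zero hT hY hZ
  · obtain rfl : b = a - 1 := by
      by_contra hne
      exact h0 (P.hom_eq_zero_of_shift h (by omega) hZ hY')
    have := P.isIso_of_shift h hZ hY' h0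
    have hX : IsZero X := Triangle.isZero₂_of_isIso₃ _ hT this
    exact extensionProduct_of_isZero hX (P.shift_of_isZero _ hX) (P.shift_of_isZero _ hX)

/-! ### Sorting and truncating words. -/

section

variable [IsTriangulated C] [P.IsSimpleMinded]

theorem shift_word_swap {a : ℤ} (l : List ℤ) (h : ∀ b ∈ l, b < a) :
    extensionProduct (P.shift a) (P.word l) ≤ extensionProduct (P.word l) (P.shift a) := by
  induction l with
  | nil =>
    change extensionProduct _ (fun X : C => IsZero X) ≤ extensionProduct (fun X : C => IsZero X) _
    rw [extensionProduct_isZero_left, extensionProduct_isZero_right]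
  | cons b l ih =>
    simp only [List.mem_cons, forall_eq_or_imp] at h
    change extensionProduct _ (extensionProduct _ _) ≤ extensionProduct (extensionProduct _ _) _
    rw [← extensionProduct_assoc]
    refine (monotone_extensionProduct_left _ (P.extensionProduct_shift_swap h.1)).trans ?_
    rw [extensionProduct_assoc, extensionProduct_assoc]
    exact monotone_extensionProduct_right _ (ih h.2)

theorem word_cons_le_orderedInsert (a : ℤ) (l : List ℤ) :
    P.word (a :: l) ≤ P.word (l.orderedInsert (· ≤ ·) a) := by
  induction l with
  | nil => exact le_rfl
  | cons b l ih =>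
    rw [List.orderedInsert_cons]
    split_ifs with h
    · exact le_rfl
    · change extensionProduct _ (extensionProduct _ _) ≤ extensionProduct _ _
      rw [← extensionProduct_assoc]
      refine (monotone_extensionProduct_left _
        (P.extensionProduct_shift_swap (not_le.1 h))).trans ?_
      rw [extensionProduct_assoc]
      exact monotone_extensionProduct_right _ ih

/-- Insertion sort exchanges only adjacent letters in decreasing order, which is exactly what the
swap lemma permits. -/
theorem word_le_insertionSort (l : List ℤ) :
    P.word l ≤ P.word (l.insertionSort (· ≤ ·)) := by
  induction l with
  | nil => exact le_rfl
  | cons a l ih =>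
    exact (monotone_extensionProduct_right _ ih).trans (P.word_cons_le_orderedInsert a _)

/-- The source of all truncation triangles: small degrees gather on the side of the subobject, large
ones on the side of the quotient. -/
theorem word_le_truncation (n : ℤ) (l : List ℤ) :
    P.word l ≤ extensionProduct (P.word (l.filter (· ≤ n))) (P.word (l.filter (n < ·))) := by
  induction l with
  | nil => exact (extensionProduct_isZero_left _).ge
  | cons a l ih =>
    refine (monotone_extensionProduct_right _ ih).trans ?_
    rw [← extensionProduct_assoc]
    by_cases h : a ≤ n
    · rw [List.filter_cons_of_pos (by simpa using h), List.filter_cons_of_neg (by simpa using h)]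
      exact le_rfl
    · rw [List.filter_cons_of_neg (by simpa using h), List.filter_cons_of_pos (by simpa using h)]
      -- Here `n < a`, so `a` may move right past all the letters `≤ n`.
      refine (monotone_extensionProduct_left _ (P.shift_word_swap _ ?_)).trans ?_
      · intro b hb
        have := (List.mem_filter.1 hb).2
        simp only [decide_eq_true_eq] at this
        omega
      · rw [extensionProduct_assoc]
        exact le_rfl

end

/-! ### Orthogonality of words, and closure under retracts. -/

section

variable [P.IsSimpleMinded]

theorem hom_eq_zero_of_word_right {X Y : C} (f : X ⟶ Y) {a : ℤ} {l : List ℤ}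
    (h : ∀ b ∈ l, a < b) (hX : P.shift a X) (hY : P.word l Y) : f = 0 := by
  induction l generalizing Y with
  | nil => exact IsZero.eq_of_tgt hY _ _
  | cons b l ih =>
    simp only [List.mem_cons, forall_eq_or_imp] at h
    obtain ⟨Y₁, Y₂, u, v, w, hT, h₁, h₂⟩ := hY
    obtain ⟨(g : X ⟶ Y₁), (hg : f = g ≫ u)⟩ :=
      Triangle.coyoneda_exact₂ _ hT f (ih (f ≫ v) h.2 h₂)
    rw [hg, P.hom_eq_zero_of_shift g h.1 hX h₁, zero_comp]

/-- Dévissage in both variables; it supplies the orthogonality axiom of the t-structure. -/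
theorem hom_eq_zero_of_word {X Y : C} (f : X ⟶ Y) {l l' : List ℤ}
    (h : ∀ a ∈ l, ∀ b ∈ l', a < b) (hX : P.word l X) (hY : P.word l' Y) : f = 0 := by
  induction l generalizing X with
  | nil => exact IsZero.eq_of_src hX _ _
  | cons a l ih =>
    simp only [List.mem_cons, forall_eq_or_imp] at h
    obtain ⟨X₁, X₂, u, v, w, hT, h₁, h₂⟩ := hX
    obtain ⟨(g : X₂ ⟶ Y), (hg : f = v ≫ g)⟩ :=
      Triangle.yoneda_exact₂ _ hT f (P.hom_eq_zero_of_word_right _ h.1 h₁ hY)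
    rw [hg, ih g h.2 h₂, comp_zero]

variable [IsTriangulated C]

/-- The cone of a nonzero morphism from `P[-a]` to an iterated extension of `P[-b]`, `a ≤ b`, is
an iterated extension with one factor less. -/
theorem exists_word_cone {X Y Z : C} (f : X ⟶ Y) (g : Y ⟶ Z) (h : Z ⟶ X⟦(1 : ℤ)⟧)
    (hT : Triangle.mk f g h ∈ distTriang C) {a : ℤ} {l : List ℤ} (hl : ∀ b ∈ l, a ≤ b)
    (hX : P.shift a X) (hY : P.word l Y) (hf : f ≠ 0) :
    ∃ l', l'.length + 1 = l.length ∧ P.word l' Z := by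
  induction l generalizing Y Z with
  | nil => exact (hf (IsZero.eq_of_tgt hY _ _)).elim
  | cons b l ih =>
    simp only [List.mem_cons, forall_eq_or_imp] at hl
    obtain ⟨Y₁, Y₂, u, v, w, hT', h₁, h₂⟩ := hY
    by_cases hv : f ≫ v = 0
    -- In this case `f` comes from a nonzero, hence invertible, map to the first factor, so the cone
    -- of `f` is the cone of `u`, namely `Y₂`.
    · obtain ⟨(φ : X ⟶ Y₁), (hφf : f = φ ≫ u)⟩ := Triangle.coyoneda_exact₂ _ hT' f hv
      have hφ : φ ≠ 0 := by rintro rfl; exact hf (by rw [hφf, zero_comp])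
      obtain rfl : a = b := by
        by_contra hne
        exact hφ (P.hom_eq_zero_of_shift φ (lt_of_le_of_ne hl.1 hne) hX h₁)
      have := P.isIso_of_shift φ hX h₁ hφ
      refine ⟨l, rfl, ?_⟩
      obtain ⟨e, -⟩ := exists_iso_of_arrow_iso _ _ hT' hT
        (Arrow.isoMk (asIso φ).symm (Iso.refl _) (by
          change inv φ ≫ f = u ≫ 𝟙 Y
          rw [hφf, IsIso.inv_hom_id_assoc, Category.comp_id]))
      exact (P.word l).prop_of_iso (Triangle.π₃.mapIso e) h₂
    -- Otherwise the induction applies to `X ⟶ Y₂`, with cone `W`, and the octahedron for `X ⟶ Y ⟶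
    -- Y₂` presents `Z` as an extension of `W` by `Y₁`.
    · obtain ⟨W, r, s, hW⟩ := distinguished_cocone_triangle (f ≫ v)
      obtain ⟨l', hl', hWl⟩ := ih _ _ _ hW hl.2 h₂ hv
      let o := Triangulated.someOctahedron rfl hT (rot_of_distTriang _ hT') hW
      refine ⟨b :: l', by simpa using hl', _, _, _, _, _, inv_rot_of_distTriang _ o.mem, ?_, hWl⟩
      refine (P.shift b).prop_of_iso ?_ h₁
      exact (shiftEquiv C (1 : ℤ)).unitIso.app Y₁

/-- Induction on the length: the first factor of a sorted word is either invisible in `M`, or can be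
removed from `M` and from `X` by taking cones, keeping a retract. -/
theorem words_of_retract {M X : C} (r : Retract M X) {l : List ℤ} (hX : P.word l X) :
    P.words M := by
  induction hn : l.length generalizing M X l with
  | zero =>
    obtain rfl := List.length_eq_zero_iff.1 hn
    refine ⟨[], (IsZero.iff_id_eq_zero M).2 ?_⟩
    rw [← r.retract, IsZero.eq_of_tgt hX r.i 0, zero_comp]
  | succ n ih =>
    -- After sorting, the first letter is minimal, as `exists_word_cone` requires.
    replace hX := P.word_le_insertionSort l X hX
    have hs := List.pairwise_insertionSort (· ≤ ·) l
    rw [← List.length_insertionSort (· ≤ ·) l] at hn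
    generalize l.insertionSort (· ≤ ·) = l at hX hs hn
    obtain _ | ⟨a, l⟩ := l
    · simp at hn
    rw [List.pairwise_cons] at hs
    have hX' := hX
    obtain ⟨W, X', u, v, w, hT, hW, hX₁⟩ := hX'
    by_cases h0 : u ≫ r.r = 0
    · obtain ⟨(s : X' ⟶ M), (hs' : r.r = v ≫ s)⟩ := Triangle.yoneda_exact₂ _ hT r.r h0
      exact ih (M := M) (X := X') ⟨r.i ≫ v, s, by
        rw [Category.assoc, ← hs', r.retract]⟩ hX₁ (by simpa using hn)
    -- `M'` and `X''` are the cones of `W ⟶ M` and of `W ⟶ M ⟶ X`. The second map is nonzero,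
    -- because composing it with `r.r` gives back `u ≫ r.r`, so `X''` has a word with one letter
    -- less.
    · obtain ⟨M', p, q, hM'⟩ := distinguished_cocone_triangle (u ≫ r.r)
      obtain ⟨X'', p', q', hX''⟩ := distinguished_cocone_triangle (u ≫ r.r ≫ r.i)
      obtain ⟨l', hl', hw⟩ := P.exists_word_cone _ _ _ hX'' (a := a) (l := a :: l)
        (by simpa using hs.1) hW hX (fun h => h0 (by
          have := congrArg (· ≫ r.r) h
          simpa using this))
      obtain ⟨(c : M' ⟶ X''), (hc₁ : p ≫ c = r.i ≫ p'), (hc₂ : q ≫ (𝟙 W)⟦(1 : ℤ)⟧' = c ≫ q')⟩ :=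
        complete_distinguished_triangle_morphism _ _ hM' hX'' (𝟙 W) r.i (by
          change (u ≫ r.r) ≫ r.i = 𝟙 W ≫ u ≫ r.r ≫ r.i
          simp)
      obtain ⟨(c' : X'' ⟶ M'), (hc₁' : p' ≫ c' = r.r ≫ p),
          (hc₂' : q' ≫ (𝟙 W)⟦(1 : ℤ)⟧' = c' ≫ q)⟩ :=
        complete_distinguished_triangle_morphism _ _ hX'' hM' (𝟙 W) r.r (by
          change (u ≫ r.r ≫ r.i) ≫ r.r = 𝟙 W ≫ u ≫ r.r
          simp)
      -- Maps between cones are not unique, so `c ≫ c'` need not be the identity. It is invertible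
      -- by the five lemma, which is enough to make `M'` a retract of `X''`.
      have hiso : IsIso (c ≫ c') := by
        let φ : Triangle.mk (u ≫ r.r) p q ⟶ Triangle.mk (u ≫ r.r) p q :=
          { hom₁ := 𝟙 W, hom₂ := 𝟙 M, hom₃ := c ≫ c'
            comm₁ := by
              change (u ≫ r.r) ≫ 𝟙 M = 𝟙 W ≫ u ≫ r.r
              simp
            comm₂ := by
              change p ≫ c ≫ c' = 𝟙 M ≫ p
              rw [reassoc_of% hc₁, hc₁', r.retract_assoc, Category.id_comp]
            comm₃ := by
              change q ≫ (𝟙 W)⟦(1 : ℤ)⟧' = (c ≫ c') ≫ q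
              rw [Category.assoc, ← hc₂', ← reassoc_of% hc₂]
              simp }
        exact isIso₃_of_isIso₁₂ φ hM' hM' (inferInstanceAs (IsIso (𝟙 W)))
          (inferInstanceAs (IsIso (𝟙 M)))
      obtain ⟨l₁, hl₁⟩ := ih (M := M') (X := X'') ⟨c, c' ≫ inv (c ≫ c'), by
        rw [← Category.assoc, IsIso.hom_inv_id]⟩ hw (by simp at hn; simp at hl'; omega)
      exact ⟨a :: l₁, _, _, _, _, _, hM', hW, hl₁⟩

instance : P.words.IsStableUnderRetracts where
  of_retract r := fun ⟨_, h⟩ => P.words_of_retract r h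

instance : P.words.IsTriangulated where
  exists_zero := ⟨_, isZero_zero C, [], isZero_zero C⟩
  isStableUnderShiftBy a := ⟨fun X ⟨l, h⟩ => ⟨_, P.word_le_shift a l X h⟩⟩
  ext₂' T hT := fun ⟨l, h⟩ ⟨l', h'⟩ => le_isoClosure _ _
    ⟨l ++ l', by rw [word_append]; exact ⟨_, _, _, _, _, hT, h, h'⟩⟩

end

end CategoryTheory.ObjectProperty

/-! ### The dg modules `L̂ = L ⊗_{A^0} A` -/

namespace DGMod

variable {A : DGAlgebra.{w, u} k}

section Hat

variable {L : Type u} [AddCommGroup L] [Module (A.gr 0)ᵐᵒᵖ L] (hA : A.ZeroDiff)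

/-- The element `l ⊗ a` of `L̂`. -/
def hatMk (a : A) (l : L) : hat L hA := (rel L A).mkQ (a ⊗ₜ[ℤ] l)

theorem hatMk_add_left (a b : A) (l : L) : hatMk hA (a + b) l = hatMk hA a l + hatMk hA b l :=
  (congrArg (rel L A).mkQ (TensorProduct.add_tmul a b l)).trans (map_add _ _ _)

theorem hatMk_add_right (a : A) (l l' : L) : hatMk hA a (l + l') = hatMk hA a l + hatMk hA a l' :=
  (congrArg (rel L A).mkQ (TensorProduct.tmul_add a l l')).trans (map_add _ _ _)

theorem hatMk_zero_left (l : L) : hatMk hA (0 : A) l = 0 :=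
  (congrArg (rel L A).mkQ (TensorProduct.zero_tmul _ l)).trans (map_zero _)

theorem smul_hatMk (a b : A) (l : L) : op b • hatMk hA a l = hatMk hA (a * b) l := rfl

theorem hatMk_mul (a₀ : A.gr 0) (a : A) (l : L) :
    hatMk hA ((a₀ : A) * a) l = hatMk hA a (op a₀ • l) :=
  (Submodule.Quotient.eq (rel L A)).2 (AddSubgroup.subset_closure ⟨a₀, a, l, rfl⟩)

theorem d_hatMk (a : A) (l : L) : (hat L hA).d (hatMk hA a l) = hatMk hA (A.d a) l := rfl

theorem hatMk_eq_smul (a : A) (l : L) : hatMk hA a l = op a • hatMk hA 1 l := by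
  rw [smul_hatMk, one_mul]

theorem hatMk_mem {i : ℤ} {a : A} (ha : a ∈ A.gr i) (l : L) : hatMk hA a l ∈ (hat L hA).gr i :=
  ⟨_, AddSubgroup.subset_closure ⟨a, ha, l, rfl⟩, rfl⟩

theorem hatMk_one_mem (l : L) : hatMk hA 1 l ∈ (hat L hA).gr 0 :=
  hatMk_mem hA (SetLike.GradedOne.one_mem (A := A.gr)) l

theorem d_hatMk_one (l : L) : (hat L hA).d (hatMk hA 1 l) = 0 := by
  rw [d_hatMk, hA _ (SetLike.GradedOne.one_mem (A := A.gr)), hatMk_zero_left]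

theorem hat_induction {motive : hat L hA → Prop} (zero : motive 0)
    (mk : ∀ a l, motive (hatMk hA a l))
    (add : ∀ x y, motive x → motive y → motive (x + y)) (x : hat L hA) : motive x := by
  obtain ⟨x, rfl⟩ := (rel L A).mkQ_surjective x
  induction x using TensorProduct.induction_on with
  | zero => exact zero
  | tmul a l => exact mk a l
  | add x y hx hy => exact add _ _ hx hy

theorem hat_gr_induction {i : ℤ} {motive : hat L hA → Prop} (zero : motive 0)
    (neg : ∀ x, motive x → motive (-x))
    (mk : ∀ a ∈ A.gr i, ∀ l, motive (hatMk hA a l))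
    (add : ∀ x y, motive x → motive y → motive (x + y)) (x : hat L hA)
    (hx : x ∈ (hat L hA).gr i) : motive x := by
  obtain ⟨x, hx, rfl⟩ := hx
  induction (hx : x ∈ tensGr L A i) using AddSubgroup.closure_induction with
  | zero => exact zero
  | mem x h =>
    obtain ⟨a, ha, l, rfl⟩ := h
    exact mk a ha l
  | add x y _ _ hx hy => exact add _ _ hx hy
  | neg x _ h => exact neg _ h

theorem hat_lin_ext {M : Type*} [AddCommGroup M] [Module (A : Type u)ᵐᵒᵖ M]
    {f g : hat L hA →ₗ[(A : Type u)ᵐᵒᵖ] M} (h : ∀ l, f (hatMk hA 1 l) = g (hatMk hA 1 l)) :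
    f = g := by
  ext x
  induction x using hat_induction hA with
  | zero => rw [map_zero, map_zero]
  | mk a l => rw [hatMk_eq_smul, map_smul, map_smul, h]
  | add x y hx hy => rw [map_add, map_add, hx, hy]

theorem hat_hom_ext {M : DGMod A} {f g : Hom (hat L hA) M}
    (h : ∀ l, f.lin (hatMk hA 1 l) = g.lin (hatMk hA 1 l)) : f = g :=
  Hom.ext (hat_lin_ext hA h)

/-- The morphism of dg modules `L̂ → M`, `l ⊗ a ↦ φ(l) a`, defined by an `A^0`-linear map `φ` from
`L` to the cocycles of degree zero of `M`. -/
def hatLift {M : DGMod A} (φ : L →+ M) (hφ : ∀ l, φ l ∈ M.gr 0) (hd : ∀ l, M.d (φ l) = 0)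
    (hl : ∀ (a₀ : A.gr 0) l, φ (op a₀ • l) = op (a₀ : A) • φ l) : Hom (hat L hA) M :=
  let ψ : (A : Type u) ⊗[ℤ] L →+ M := TensorProduct.liftAddHom
    { toFun := fun a => (DistribSMul.toAddMonoidHom M (op a)).comp φ
      map_zero' := by ext; simp
      map_add' := fun a b => by ext; simp [add_smul] } (fun n a l => by
        change op (n • a) • φ l = op a • φ (n • l)
        rw [map_zsmul, smul_comm (op a), MulOpposite.op_smul, smul_assoc])
  have hψ : ∀ a l, ψ (a ⊗ₜ[ℤ] l) = op a • φ l := fun _ _ => rfl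
  let ψ' : tens L A →ₗ[(A : Type u)ᵐᵒᵖ] M :=
    { ψ with
      map_smul' := fun c x => by
        change ψ (c • x) = c • ψ x
        induction x using TensorProduct.induction_on with
        | zero => simp
        | add x y hx hy => rw [smul_add, map_add, hx, hy, map_add, smul_add]
        | tmul a l =>
          change ψ ((c • a) ⊗ₜ[ℤ] l) = _
          rw [hψ, hψ, smul_smul]
          rfl }
  have hrel : rel L A ≤ LinearMap.ker ψ' := by
    intro x hx
    change ψ x = 0
    induction (hx : x ∈ relGrp L A) using AddSubgroup.closure_induction with
    | zero => exact map_zero _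
    | neg x _ h => rw [map_neg, h, neg_zero]
    | add x y _ _ hx hy => rw [map_add, hx, hy, add_zero]
    | mem x h =>
      obtain ⟨a₀, a, l, rfl⟩ := h
      rw [map_sub, hψ, hψ, hl, smul_smul]
      exact sub_self _
  let F : hat L hA →ₗ[(A : Type u)ᵐᵒᵖ] M := (rel L A).liftQ ψ' hrel
  have hF : ∀ a l, F (hatMk hA a l) = op a • φ l := fun _ _ => rfl
  { lin := F
    map_mem := fun {i x} hx => by
      refine hat_gr_induction hA (motive := fun x => F x ∈ M.gr i) ?_ (fun x h => ?_)
        (fun a ha l => ?_) (fun x y hx hy => ?_) x hx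
      · rw [map_zero]; exact zero_mem _
      · rw [map_neg]; exact neg_mem h
      · rw [hF]
        simpa using M.smul_mem (hφ l) ha
      · rw [map_add]; exact add_mem hx hy
    comm := fun x => by
      induction x using hat_induction hA with
      | zero => simp
      | mk a l =>
        -- `φ l` is a cocycle of degree zero, so only `φ(l) · d a` survives in the Leibniz rule,
        -- with sign `+1`.
        rw [d_hatMk, hF, hF, M.leibniz a (hφ l), hd]
        simp
      | add x y hx hy => simp only [map_add, hx, hy] }

variable {L₁ L₂ : Type u} [AddCommGroup L₁] [Module (A.gr 0)ᵐᵒᵖ L₁]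
  [AddCommGroup L₂] [Module (A.gr 0)ᵐᵒᵖ L₂]

/-- The morphism `L̂ → L̂₁` induced by an `A^0`-linear map. -/
def hatMap (f : L →ₗ[(A.gr 0)ᵐᵒᵖ] L₁) : Hom (hat L hA) (hat L₁ hA) :=
  hatLift hA
    { toFun := fun l => hatMk hA 1 (f l)
      map_zero' := by
        have := hatMk_add_right hA 1 (0 : L₁) 0
        rw [add_zero] at this
        rw [map_zero]
        exact left_eq_add.1 this
      map_add' := fun l l' => by rw [map_add, hatMk_add_right] }
    (fun l => hatMk_one_mem hA _) (fun l => d_hatMk_one hA _)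
    (fun a₀ l => by
      change hatMk hA 1 (f (op a₀ • l)) = op (a₀ : A) • hatMk hA 1 (f l)
      rw [map_smul, ← hatMk_mul, mul_one, ← hatMk_eq_smul])

@[simp] theorem hatMap_hatMk (f : L →ₗ[(A.gr 0)ᵐᵒᵖ] L₁) (a : A) (l : L) :
    (hatMap hA f).lin (hatMk hA a l) = hatMk hA a (f l) :=
  (hatMk_eq_smul hA a (f l)).symm

theorem hatMap_comp (f : L →ₗ[(A.gr 0)ᵐᵒᵖ] L₁) (g : L₁ →ₗ[(A.gr 0)ᵐᵒᵖ] L₂) :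
    (hatMap hA f).comp (hatMap hA g) = hatMap hA (g.comp f) :=
  hat_hom_ext hA fun l => by simp

theorem hatMap_id : hatMap hA (LinearMap.id : L →ₗ[(A.gr 0)ᵐᵒᵖ] L) = Hom.id _ :=
  hat_hom_ext hA fun l => by simp

theorem hatMap_zero : hatMap hA (0 : L →ₗ[(A.gr 0)ᵐᵒᵖ] L₁) = 0 :=
  hat_hom_ext hA fun l => by
    rw [hatMap_hatMk, LinearMap.zero_apply, Hom.lin_zero, LinearMap.zero_apply]
    have := hatMk_add_right hA 1 (0 : L₁) 0
    rw [add_zero] at this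
    exact left_eq_add.1 this

theorem hatMap_add (f g : L →ₗ[(A.gr 0)ᵐᵒᵖ] L₁) :
    hatMap hA (f + g) = hatMap hA f + hatMap hA g :=
  hat_hom_ext hA fun l => by simp [hatMk_add_right]

/-- The projection `L̂ → L`, `l ⊗ a ↦ l a₀`, where `a₀` is the component of degree zero of `a`. -/
def hatProj : hat L hA →+ L :=
  QuotientAddGroup.lift (rel L A).toAddSubgroup
    (TensorProduct.liftAddHom
      { toFun := fun a => DistribSMul.toAddMonoidHom L (op (DirectSum.decompose A.gr a 0))
        map_zero' := by
          ext l
          rw [DirectSum.decompose_zero]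
          exact zero_smul (A.gr 0)ᵐᵒᵖ l
        map_add' := fun a b => by ext; simp [add_smul] } (fun n a l => by
          change op (DirectSum.decompose A.gr (n • a) 0) • l =
            op (DirectSum.decompose A.gr a 0) • n • l
          have : DirectSum.decompose A.gr (n • a) = n • DirectSum.decompose A.gr a :=
            map_zsmul (DirectSum.decomposeAddEquiv A.gr) n a
          rw [this, smul_comm, DirectSum.smul_apply, MulOpposite.op_smul, smul_assoc]))
    (by
      intro x hx
      induction (hx : x ∈ relGrp L A) using AddSubgroup.closure_induction with
      | zero => exact map_zero _
      | neg x _ h =>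
        rw [AddMonoidHom.mem_ker, map_neg, AddMonoidHom.mem_ker.1 h, neg_zero]
      | add x y _ _ hx hy =>
        rw [AddMonoidHom.mem_ker, map_add, AddMonoidHom.mem_ker.1 hx,
          AddMonoidHom.mem_ker.1 hy, add_zero]
      | mem x h =>
        obtain ⟨a₀, a, l, rfl⟩ := h
        rw [AddMonoidHom.mem_ker, map_sub, sub_eq_zero]
        change op (DirectSum.decompose A.gr ((a₀ : A) * a) 0) • l =
            op (DirectSum.decompose A.gr a 0) • op a₀ • l
        rw [smul_smul, ← MulOpposite.op_mul]
        congr 2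
        exact Subtype.ext (DirectSum.coe_decompose_mul_of_left_mem_zero A.gr a₀.2))

theorem hatProj_hatMk (a : A) (l : L) :
    hatProj hA (hatMk hA a l) = op (DirectSum.decompose A.gr a 0) • l := rfl

theorem hatProj_hatMk_coe (a : A.gr 0) (l : L) : hatProj hA (hatMk hA (a : A) l) = op a • l := by
  rw [hatProj_hatMk, DirectSum.decompose_coe, DirectSum.of_eq_same]

theorem hatProj_hatMk_one (l : L) : hatProj hA (hatMk hA 1 l) = l := by
  have := hatProj_hatMk_coe hA (1 : A.gr 0) l
  simpa using this

theorem hatProj_hatMk_of_ne {i : ℤ} (hi : i ≠ 0) {a : A} (ha : a ∈ A.gr i) (l : L) :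
    hatProj hA (hatMk hA a l) = 0 := by
  have : DirectSum.decompose A.gr a 0 = 0 :=
    Subtype.ext (DirectSum.decompose_of_mem_ne A.gr ha hi)
  rw [hatProj_hatMk, this]
  exact zero_smul (A.gr 0)ᵐᵒᵖ l

/-- In degree zero, `l ⊗ a₀ = l a₀ ⊗ 1`; thus the part of degree zero of `L̂` is a copy of `L`. -/
theorem hatMk_hatProj (x : hat L hA) (hx : x ∈ (hat L hA).gr 0) :
    hatMk hA 1 (hatProj hA x) = x := by
  have hadd : ∀ l l' : L, hatMk hA 1 (l + l') = hatMk hA 1 l + hatMk hA 1 l' :=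
    hatMk_add_right hA 1
  let φ : L →+ hat L hA := AddMonoidHom.mk' (hatMk hA 1) hadd
  change φ (hatProj hA x) = x
  refine hat_gr_induction hA (i := 0) (motive := fun x => φ (hatProj hA x) = x) ?_ (fun x h => ?_)
    (fun a ha l => ?_) (fun x y hx hy => ?_) x hx
  · rw [map_zero, map_zero]
  · rw [map_neg, map_neg, h]
  · lift a to A.gr 0 using ha
    change hatMk hA 1 _ = _
    rw [hatProj_hatMk_coe, ← hatMk_mul, mul_one]
  · rw [map_add, map_add, hx, hy]

theorem hatProj_smul (a₀ : A.gr 0) (x : hat L hA) (hx : x ∈ (hat L hA).gr 0) :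
    hatProj hA (op (a₀ : A) • x) = op a₀ • hatProj hA x := by
  conv_lhs => rw [← hatMk_hatProj hA x hx, ← hatMk_eq_smul, hatProj_hatMk_coe]

/-- A morphism is determined on the generators `l ⊗ 1`, whose images lie in degree zero, that is, in
`L₁`. This makes Schur's lemma available for `L̂`. -/
theorem hatMap_surjective (f : Hom (hat L hA) (hat L₁ hA)) :
    ∃ g : L →ₗ[(A.gr 0)ᵐᵒᵖ] L₁, hatMap hA g = f := by
  have hf : ∀ l : L, f.lin (hatMk hA 1 l) ∈ (hat L₁ hA).gr 0 := fun l =>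
    f.map_mem (hatMk_one_mem hA l)
  refine ⟨{ toFun := fun l => hatProj hA (f.lin (hatMk hA 1 l))
            map_add' := fun l l' => by rw [hatMk_add_right, map_add, map_add]
            map_smul' := fun c l => ?_ }, hat_hom_ext hA fun l => ?_⟩
  · obtain ⟨a₀, rfl⟩ := MulOpposite.op_surjective c
    rw [← hatMk_mul, mul_one, hatMk_eq_smul, map_smul, hatProj_smul hA _ _ (hf l)]
    rfl
  · rw [hatMap_hatMk]
    exact hatMk_hatProj hA _ (hf l)

/-! ### Consequences of the vanishing of `A` in negative degrees. -/

section Positive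

variable (hP : A.IsPositive)
include hP

theorem hat_gr_eq_bot {i : ℤ} (hi : i < 0) (x : hat L hA) (hx : x ∈ (hat L hA).gr i) : x = 0 := by
  refine hat_gr_induction hA (i := i) (motive := fun x => x = 0) rfl (fun x h => ?_)
    (fun a ha l => ?_) (fun x y hx hy => ?_) x hx
  · rw [h, neg_zero]
  · rw [hP i hi, Submodule.mem_bot] at ha
    rw [ha, hatMk_zero_left]
  · rw [hx, hy, add_zero]

/-- Without negative degrees, a product with a factor of positive degree has no component in degree
zero. -/
theorem hatProj_eq_zero (x : hat L hA) (hx : x ∈ (hat L hA).mulPosGrp) : hatProj hA x = 0 := by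
  induction hx using AddSubgroup.closure_induction with
  | zero => exact map_zero _
  | neg x _ h => rw [map_neg, h, neg_zero]
  | add x y _ _ hx hy => rw [map_add, hx, hy, add_zero]
  | mem x h =>
    obtain ⟨m, j, a, hj, ha, rfl⟩ := h
    induction m using hat_induction hA with
    | zero => rw [smul_zero, map_zero]
    | add x y hx hy => rw [smul_add, map_add, hx, hy, add_zero]
    | mk b l =>
      rw [smul_hatMk]
      refine DirectSum.Decomposition.inductionOn A.gr
        (motive := fun b : A => hatProj hA (hatMk hA (b * a) l) = 0) ?_ (fun {i} b => ?_)
        (fun b b' hb hb' => ?_) b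
      · rw [zero_mul, hatMk_zero_left, map_zero]
      · by_cases hi : i < 0
        · have hb : (b : A) = 0 := (Submodule.mem_bot k).1 ((hP i hi).le b.2)
          rw [hb, zero_mul, hatMk_zero_left, map_zero]
        · exact hatProj_hatMk_of_ne hA (i := i + j) (by omega)
            (SetLike.GradedMul.mul_mem (A := A.gr) b.2 ha) l
      · rw [add_mul, hatMk_add_left, map_add, hb, hb', add_zero]

/-- The generators `l ⊗ 1` of the shifted module have degree `-n`, where the target is zero. The
vanishing holds already before passing to homotopy. -/
theorem hom_shift_hat_eq_zero {n : ℤ} (hn : 0 < n) (f : Hom ((hat L hA).shift n) (hat L₁ hA)) :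
    f = 0 := by
  refine Hom.ext (hat_lin_ext hA fun l => ?_)
  have hl : hatMk hA 1 l ∈ (hat L hA).gr (-n + n) := by
    rw [neg_add_cancel]
    exact hatMk_one_mem hA l
  exact hat_gr_eq_bot hA hP (neg_lt_zero.2 hn) _ (f.map_mem hl)

end Positive

end Hat

end DGMod

/-! ### Vanishing of the cohomology of `M ⊗_A A^0` -/

namespace DGMod

variable {A : DGAlgebra.{w, u} k}

/-- Only linearity matters, so this covers homotopies and the structure maps of cones. -/
theorem map_mulPosGrp {M N : DGMod A} (h : M →ₗ[(A : Type u)ᵐᵒᵖ] N) {x : M}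
    (hx : x ∈ M.mulPosGrp) : h x ∈ N.mulPosGrp := by
  induction hx using AddSubgroup.closure_induction with
  | zero => rw [map_zero]; exact zero_mem _
  | neg x _ h => rw [map_neg]; exact neg_mem h
  | add x y _ _ hx hy => rw [map_add]; exact add_mem hx hy
  | mem x hx =>
    obtain ⟨m, j, a, hj, ha, rfl⟩ := hx
    rw [map_smul]
    exact N.smul_mem_mulPosGrp hj ha _

/-- The condition `H^i(M / M A^+) = 0`, in terms of elements of `M`. -/
def BarVanish (i : ℤ) (M : DGMod A) : Prop :=
  ∀ x ∈ M.gr i, M.d x ∈ M.mulPosGrp → ∃ y ∈ M.gr (i - 1), x - M.d y ∈ M.mulPosGrp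

theorem notMem_suppH_bar_iff (hA : A.IsPositive) (M : DGMod A) (i : ℤ) :
    i ∉ (M.bar hA).suppH ↔ BarVanish i M := by
  have h₁ : i ∉ (M.bar hA).suppH ↔ (M.bar hA).cocycles i ≤ (M.bar hA).coboundaries i := by
    rw [← AddSubgroup.addSubgroupOf_eq_top, ← QuotientAddGroup.subsingleton_iff]
    exact not_nontrivial_iff_subsingleton
  have hmk : ∀ x : M, (M.mulPos hA).mkQ x = 0 ↔ x ∈ M.mulPosGrp := fun x =>
    Submodule.Quotient.mk_eq_zero _
  rw [h₁]
  constructor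
  · intro h x hx hdx
    obtain ⟨_, ⟨y, hy, rfl⟩, hy'⟩ := h (x := (M.mulPos hA).mkQ x)
      ⟨(hmk (M.d x)).2 hdx, x, hx, rfl⟩
    refine ⟨y, hy, (hmk _).1 ?_⟩
    rw [map_sub, sub_eq_zero]
    exact hy'.symm
  · rintro h _ ⟨hd, x, hx, rfl⟩
    obtain ⟨y, hy, hxy⟩ := h x hx ((hmk _).1 hd)
    refine ⟨(M.mulPos hA).mkQ y, ⟨y, hy, rfl⟩, ?_⟩
    rw [← hmk, map_sub, sub_eq_zero] at hxy
    exact hxy.symm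

theorem BarVanish.of_homotopy {i : ℤ} {M N : DGMod A} (hM : BarVanish i M) (f : Hom M N)
    (g : Hom N M) (h : IsNull (Hom.id N - g.comp f)) : BarVanish i N := by
  intro x hx hdx
  obtain ⟨s, hs₁, hs₂⟩ := h
  obtain ⟨y, hy, hxy⟩ := hM (g.lin x) (g.map_mem hx) (by rw [← g.comm]; exact map_mulPosGrp _ hdx)
  -- The homotopy gives `x = f (g x) + d (s x) + s (d x)`, where `s (d x)` lies in `N A^+` and `f (g
  -- x)` is `d (f y)` modulo `N A^+`.
  refine ⟨f.lin y + s x, add_mem (f.map_mem hy) (hs₁ i x hx), ?_⟩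
  have h := hs₂ x
  simp only [Hom.lin_sub, Hom.comp_lin, LinearMap.sub_apply, LinearMap.comp_apply, Hom.id_lin,
    LinearMap.id_apply] at h
  have h' := map_mulPosGrp f.lin hxy
  rw [map_sub, f.comm] at h'
  have : x - N.d (f.lin y + s x) = (f.lin (g.lin x) - N.d (f.lin y)) + s (N.d x) := by
    rw [map_add, show s (N.d x) = x - f.lin (g.lin x) - N.d (s x) by rw [h]; abel]
    abel
  rw [this]
  exact add_mem h' (map_mulPosGrp s hdx)

theorem mem_gr_of_eq {M : DGMod A} {i j : ℤ} (h : i = j) {x : M} (hx : x ∈ M.gr i) :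
    x ∈ M.gr j := h ▸ hx

theorem barVanish_shift_iff (M : DGMod A) (i n : ℤ) :
    BarVanish i (M.shift n) ↔ BarVanish (i + n) M := by
  have hd : (∀ x : M, (M.shift n).d x = M.d x) ∨ (∀ x : M, (M.shift n).d x = -M.d x) := by
    rcases Int.units_eq_one_or n.negOnePow with h | h
    · exact Or.inl fun x => by simp [h]
    · exact Or.inr fun x => by simp [h]
  have hx : ∀ x : M, x ∈ (M.shift n).mulPosGrp ↔ x ∈ M.mulPosGrp := fun _ => Iff.rfl
  have hneg : ∀ x : M, M.d x ∈ M.mulPosGrp ↔ (M.shift n).d x ∈ M.mulPosGrp := fun x => by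
    rcases hd with h | h <;> simp [h]
  constructor
  · intro h x hx hdx
    obtain ⟨y, hy, hxy⟩ := h x hx ((hneg x).1 hdx)
    have hy' : y ∈ M.gr (i + n - 1) := mem_gr_of_eq (by ring) (show y ∈ M.gr (i - 1 + n) from hy)
    rcases hd with h | h
    · exact ⟨y, hy', by rwa [h] at hxy⟩
    · exact ⟨-y, neg_mem hy', by rw [h] at hxy; rw [map_neg]; exact hxy⟩
  · intro h x hx hdx
    obtain ⟨y, hy, hxy⟩ := h x hx ((hneg x).2 hdx)
    have hy' : y ∈ (M.shift n).gr (i - 1) :=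
      mem_gr_of_eq (M := M) (show i + n - 1 = i - 1 + n by ring) hy
    rcases hd with h | h
    · exact ⟨y, hy', by rw [h]; exact hxy⟩
    · exact ⟨-y, neg_mem hy', by rw [map_neg, h, neg_neg]; exact hxy⟩

/-- Exactness of `H^i(N̄) → H^i(cone) → H^{i+1}(M̄)`, as a diagram chase modulo `A^+`. -/
theorem barVanish_cone {M N : DGMod A} (f : Hom M N) {i : ℤ} (hN : BarVanish i N)
    (hM : BarVanish (i + 1) M) : BarVanish i (cone f) := by
  rintro ⟨n, m⟩ ⟨hn, hm⟩ hd
  have h₁ : N.d n + f.lin m ∈ N.mulPosGrp ∧ -M.d m ∈ M.mulPosGrp := by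
    generalize hz : (cone f).d (n, m) = z at hd
    have hz' : z = (N.d n + f.lin m, -M.d m) := hz.symm
    have : z.1 ∈ N.mulPosGrp ∧ z.2 ∈ M.mulPosGrp := by
      clear hz hz'
      exact ⟨map_mulPosGrp (M := cone f) (LinearMap.fst _ N M) hd,
        map_mulPosGrp (M := cone f) (N := M) (LinearMap.snd _ N M) hd⟩
    rwa [hz'] at this
  obtain ⟨m', hm', hmm'⟩ := hM m hm (by simpa using neg_mem h₁.2)
  have h₂ : N.d (n + f.lin m') ∈ N.mulPosGrp := by
    have := sub_mem h₁.1 (map_mulPosGrp f.lin hmm')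
    rw [map_sub, f.comm] at this
    rw [map_add]
    convert this using 1
    abel
  have hm'' : m' ∈ M.gr i := mem_gr_of_eq (by ring) hm'
  obtain ⟨n', hn', hnn'⟩ := hN (n + f.lin m') (add_mem hn (f.map_mem hm'')) h₂
  -- The sign is forced by the cone differential: `d (n', -m') = (d n' - f m', d m')`.
  refine ⟨(n', -m'), ⟨hn', (M.gr _).neg_mem (mem_gr_of_eq (by ring) hm')⟩, ?_⟩
  have h₃ := add_mem (map_mulPosGrp (N := cone f) (LinearMap.inl _ N M) hnn')
    (map_mulPosGrp (M := M) (N := cone f) (LinearMap.inr _ N M) hmm')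
  convert h₃ using 1
  ext
  · simp
    abel
  · simp

section Hat

variable {L : Type u} [AddCommGroup L] [Module (A.gr 0)ᵐᵒᵖ L] (hA : A.ZeroDiff)

theorem barVanish_hat (hP : A.IsPositive) {i : ℤ} (hi : i ≠ 0) : BarVanish i (hat L hA) := by
  intro x hx _
  refine ⟨0, zero_mem _, ?_⟩
  rw [map_zero, sub_zero]
  rcases hi.lt_or_gt with hi | hi
  · rw [hat_gr_eq_bot hA hP hi x hx]
    exact zero_mem _
  · refine hat_gr_induction hA (i := i) (motive := fun x => x ∈ (hat L hA).mulPosGrp) (zero_mem _)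
      (fun x h => neg_mem h) (fun a ha l => ?_) (fun x y hx hy => add_mem hx hy) x hx
    rw [hatMk_eq_smul]
    exact smul_mem_mulPosGrp _ hi ha _

/-- There are no coboundaries from degree `-1`, so each cocycle `l ⊗ 1` would lie in `L̂ A^+`, which
the projection to `L` kills. -/
theorem subsingleton_of_barVanish_hat (hP : A.IsPositive) (h : BarVanish 0 (hat L hA)) :
    Subsingleton L := by
  refine subsingleton_of_forall_eq 0 fun l => ?_
  obtain ⟨y, hy, hxy⟩ := h (hatMk hA 1 l) (hatMk_one_mem hA l) (by
    rw [d_hatMk_one]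
    exact zero_mem _)
  rw [hat_gr_eq_bot hA hP (by norm_num) y hy, map_zero, sub_zero] at hxy
  rw [← hatProj_hatMk_one hA l, hatProj_eq_zero hA hP _ hxy]

end Hat

end DGMod

namespace DGHot

variable {A : DGAlgebra.{w, u} k}

/-- The objects `M` of `dgHot(A)` with `H^i(M / M A^+) = 0`. -/
def barVanish (A : DGAlgebra.{w, u} k) (i : ℤ) : ObjectProperty (DGHot A) :=
  fun X => X.as.BarVanish i

instance (i : ℤ) : (barVanish A i).IsClosedUnderIsomorphisms where
  of_iso {X Y} e h := by
    obtain ⟨f, hf⟩ := mk_surj e.hom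
    obtain ⟨g, hg⟩ := mk_surj e.inv
    refine DGMod.BarVanish.of_homotopy h f g ((mk_eq_iff _ _).1 ?_)
    have := e.inv_hom_id
    rw [← hf, ← hg] at this
    exact this.symm

theorem barVanish_shift (i n : ℤ) (X : DGHot A) :
    barVanish A i (X⟦n⟧) ↔ barVanish A (i + n) X :=
  DGMod.barVanish_shift_iff X.as i n

/-- By inverse rotation the middle object is a cone of a map from the third object shifted by `-1`
to the first. -/
theorem barVanish_ext (i : ℤ) (T : Triangle (DGHot A)) (hT : T ∈ distTriang (DGHot A))
    (h₁ : barVanish A i T.obj₁) (h₃ : barVanish A i T.obj₃) : barVanish A i T.obj₂ := by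
  obtain ⟨M, N, f, ⟨e⟩⟩ := inv_rot_of_distTriang _ hT
  refine (barVanish A i).prop_of_iso (Triangle.π₃.mapIso e).symm (DGMod.barVanish_cone f ?_ ?_)
  · exact (barVanish A i).prop_of_iso (Triangle.π₂.mapIso e) h₁
  · refine (barVanish A (i + 1)).prop_of_iso (Triangle.π₁.mapIso e) ?_
    exact (barVanish_shift (i + 1) (-1) T.obj₃).2 (by simpa using h₃)

end DGHot

/-! ### The t-structure defined by a simple-minded class and a detecting cohomology theory -/

namespace CategoryTheory.ObjectProperty

variable {C : Type*} [Category* C] [HasZeroObject C] [HasShift C ℤ]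
  [Preadditive C] [∀ (n : ℤ), (shiftFunctor C n).Additive] [Pretriangulated C]

theorem words_exists_truncation (P : ObjectProperty C) [P.IsSimpleMinded] [IsTriangulated C]
    {X : C} (hX : P.words X) (n : ℤ) :
    ∃ (l l' : List ℤ), (∀ a ∈ l, a ≤ n) ∧ (∀ a ∈ l', n < a) ∧
      extensionProduct (P.word l) (P.word l') X := by
  obtain ⟨l, hX⟩ := hX
  exact ⟨_, _, fun a ha => by simpa using (List.mem_filter.1 ha).2,
    fun a ha => by simpa using (List.mem_filter.1 ha).2, P.word_le_truncation n l X hX⟩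

/-- The family `Z i` of classes of objects behaves as the vanishing of the `i`-th cohomology of a
cohomological functor that is concentrated in degree zero on `P`, and detects zero objects there. -/
structure IsDetectedBy (P : ObjectProperty C) (Z : ℤ → ObjectProperty C) : Prop where
  iso (i : ℤ) : (Z i).IsClosedUnderIsomorphisms
  shift_iff (i n : ℤ) (X : C) : Z i (X⟦n⟧) ↔ Z (i + n) X
  ext₂ (i : ℤ) (T : Triangle C) : T ∈ distTriang C → Z i T.obj₁ → Z i T.obj₃ → Z i T.obj₂
  of_ne {i : ℤ} {X : C} : i ≠ 0 → P X → Z i X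
  isZero {X : C} : P X → Z 0 X → IsZero X

namespace IsDetectedBy

variable {P : ObjectProperty C} {Z : ℤ → ObjectProperty C} (hZ : P.IsDetectedBy Z)
include hZ

theorem ext₃ {i : ℤ} {X Y W : C} {f : X ⟶ Y} {g : Y ⟶ W} {h : W ⟶ X⟦(1 : ℤ)⟧}
    (hT : Triangle.mk f g h ∈ distTriang C) (hY : Z i Y) (hX : Z (i + 1) X) : Z i W :=
  hZ.ext₂ i _ (rot_of_distTriang _ hT) hY ((hZ.shift_iff i 1 X).2 hX)

theorem ext₁ {i : ℤ} {X Y W : C} {f : X ⟶ Y} {g : Y ⟶ W} {h : W ⟶ X⟦(1 : ℤ)⟧}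
    (hT : Triangle.mk f g h ∈ distTriang C) (hY : Z i Y) (hW : Z (i - 1) W) : Z i X :=
  hZ.ext₂ i _ (inv_rot_of_distTriang _ hT) ((hZ.shift_iff i (-1) W).2 hW) hY

theorem of_shift {i a : ℤ} {X : C} (hi : i ≠ a) (hX : P.shift a X) : Z i X := by
  have := (hZ.shift_iff (i - a) a X).1 (hZ.of_ne (sub_ne_zero.2 hi) hX)
  rwa [sub_add_cancel] at this

theorem isZero_of_shift {a : ℤ} {X : C} (hX : P.shift a X) (h : Z a X) : IsZero X := by
  have := hZ.isZero hX ((hZ.shift_iff 0 a X).2 (by rwa [zero_add]))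
  rw [IsZero.iff_id_eq_zero] at this ⊢
  exact (shiftFunctor C a).map_injective (by rw [Functor.map_id, this, Functor.map_zero])

variable [P.IsSimpleMinded]

theorem of_word {i : ℤ} {l : List ℤ} (hi : i ∉ l) {X : C} (hX : P.word l X) : Z i X := by
  induction l generalizing X with
  -- A zero object lies in every shift of `P`; any degree other than `i` would serve.
  | nil => exact hZ.of_shift (a := i + 1) (by simp) (P.shift_of_isZero _ hX)
  | cons a l ih =>
    simp only [List.mem_cons, not_or] at hi
    obtain ⟨_, _, _, _, _, hT, h₁, h₂⟩ := hX
    exact hZ.ext₂ i _ hT (hZ.of_shift hi.1 h₁) (ih hi.2 h₂)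

theorem exists_bounds {X : C} (hX : P.words X) :
    ∃ a b : ℤ, (∀ i, i < a → Z i X) ∧ ∀ i, b < i → Z i X := by
  obtain ⟨l, hX⟩ := hX
  obtain ⟨a, ha⟩ := l.toFinset.bddBelow
  obtain ⟨b, hb⟩ := l.toFinset.bddAbove
  refine ⟨a, b, fun i hi => hZ.of_word (fun h => ?_) hX, fun i hi => hZ.of_word (fun h => ?_) hX⟩
  · exact (ha (by simpa using h)).not_gt hi
  · exact (hb (by simpa using h)).not_gt hi

variable [IsTriangulated C]

/-- In a sorted word the factor of lowest degree cannot be cancelled by the others, so it must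
vanish itself, and the remaining word is shorter. -/
theorem isZero_of_words {X : C} (hX : P.words X) (h : ∀ i, Z i X) : IsZero X := by
  obtain ⟨l, hX⟩ := hX
  replace hX := P.word_le_insertionSort l X hX
  have hs := List.pairwise_insertionSort (· ≤ ·) l
  generalize l.insertionSort (· ≤ ·) = l at hX hs
  induction l generalizing X with
  | nil => exact hX
  | cons a l ih =>
    rw [List.pairwise_cons] at hs
    obtain ⟨Y, W, f, g, _, hT, h₁, h₂⟩ := hX
    -- The remaining letters are `≥ a`, so nothing in degree `a - 1` of `W` maps to degree `a` of
    -- `Y`.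
    have hW : Z (a - 1) W := hZ.of_word (fun hm => by have := hs.1 _ hm; omega) h₂
    have hY : IsZero Y := hZ.isZero_of_shift h₁ (hZ.ext₁ hT (h a) hW)
    have : IsIso g := (Triangle.isZero₁_iff_isIso₂ _ hT).1 hY
    have := hZ.iso
    exact (ih (fun i => (Z i).prop_of_iso (asIso g) (h i)) h₂ hs.2).of_iso (asIso g)

/-- A converse to `of_word`: the upper part of the truncation triangle has no cohomology at all,
hence is zero. -/
theorem exists_word_le {X : C} (hX : P.words X) {n : ℤ} (h : ∀ i, n < i → Z i X) :
    ∃ l : List ℤ, (∀ a ∈ l, a ≤ n) ∧ P.word l X := by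
  obtain ⟨l, l', hl, hl', Y, W, f, g, _, hT, h₁, h₂⟩ := P.words_exists_truncation hX n
  have hW : IsZero W := hZ.isZero_of_words ⟨_, h₂⟩ fun i => by
    by_cases hi : n < i
    · exact hZ.ext₃ hT (h i hi) (hZ.of_word (fun hm => by have := hl _ hm; omega) h₁)
    · exact hZ.of_word (fun hm => hi (hl' _ hm)) h₂
  have : IsIso f := (Triangle.isZero₃_iff_isIso₁ _ hT).1 hW
  exact ⟨l, hl, (P.word l).prop_of_iso (asIso f) h₁⟩

theorem exists_word_gt {X : C} (hX : P.words X) {n : ℤ} (h : ∀ i, i ≤ n → Z i X) :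
    ∃ l : List ℤ, (∀ a ∈ l, n < a) ∧ P.word l X := by
  obtain ⟨l, l', hl, hl', Y, W, f, g, _, hT, h₁, h₂⟩ := P.words_exists_truncation hX n
  have hY : IsZero Y := hZ.isZero_of_words ⟨_, h₁⟩ fun i => by
    by_cases hi : i ≤ n
    · exact hZ.ext₁ hT (h i hi) (hZ.of_word (fun hm => by have := hl' _ hm; omega) h₂)
    · exact hZ.of_word (fun hm => hi (hl _ hm)) h₁
  have : IsIso g := (Triangle.isZero₁_iff_isIso₂ _ hT).1 hY
  exact ⟨l', hl', (P.word l').prop_of_iso (asIso g).symm h₂⟩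

/-- The t-structure on the triangulated subcategory generated by `P`. -/
def tStructure (Q : ObjectProperty C) [Q.IsTriangulated] (hQ : Q = P.words) :
    Triangulated.TStructure Q.FullSubcategory where
  le n := fun X => ∀ i, n < i → Z i X.obj
  ge n := fun X => ∀ i, i < n → Z i X.obj
  le_isClosedUnderIsomorphisms n := ⟨fun e h i hi =>
    have := hZ.iso i; (Z i).prop_of_iso (Q.ι.mapIso e) (h i hi)⟩
  ge_isClosedUnderIsomorphisms n := ⟨fun e h i hi =>
    have := hZ.iso i; (Z i).prop_of_iso (Q.ι.mapIso e) (h i hi)⟩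
  le_shift n a n' h X hX i hi := have := hZ.iso i
    (Z i).prop_of_iso ((Q.ι.commShiftIso a).symm.app X)
      ((hZ.shift_iff i a X.obj).2 (hX _ (by omega)))
  ge_shift n a n' h X hX i hi := have := hZ.iso i
    (Z i).prop_of_iso ((Q.ι.commShiftIso a).symm.app X)
      ((hZ.shift_iff i a X.obj).2 (hX _ (by omega)))
  zero' X Y f hX hY := by
    obtain ⟨l, hl, hlX⟩ := hZ.exists_word_le (hQ ▸ X.property) hX
    -- Membership in the half `≥ 1` means vanishing in degrees `≤ 0`, so the letters of `Y` are
    -- positive and those of `X` are not.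
    obtain ⟨l', hl', hlY⟩ := hZ.exists_word_gt (n := 0) (hQ ▸ Y.property)
      (fun i hi => hY i (by omega))
    apply Q.ι.map_injective
    rw [Functor.map_zero]
    exact P.hom_eq_zero_of_word _ (fun a ha b hb => (hl a ha).trans_lt (hl' b hb)) hlX hlY
  le_zero_le X hX i hi := hX i (by omega)
  ge_one_le X hX i hi := hX i (by omega)
  exists_triangle_zero_one X := by
    obtain ⟨l, l', hl, hl', Y, W, f, g, h, hT, h₁, h₂⟩ :=
      P.words_exists_truncation (hQ ▸ X.property : P.words X.obj) 0
    let Y' : Q.FullSubcategory := ⟨Y, hQ ▸ ⟨l, h₁⟩⟩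
    refine ⟨Y', ⟨W, hQ ▸ ⟨l', h₂⟩⟩, fun i hi => ?_, fun i hi => ?_,
      Q.fullyFaithfulι.preimage f, Q.fullyFaithfulι.preimage g,
      Q.fullyFaithfulι.preimage (h ≫ (Q.ι.commShiftIso (1 : ℤ)).inv.app Y'),
      isomorphic_distinguished _ hT _
        (Triangle.isoMk _ _ (Iso.refl _) (Iso.refl _) (Iso.refl _) ?_ ?_ ?_)⟩
    · exact hZ.of_word (fun hm => by have := hl _ hm; omega) h₁
    · exact hZ.of_word (fun hm => by have := hl' _ hm; omega) h₂
    · change f ≫ 𝟙 _ = 𝟙 _ ≫ f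
      simp
    · change g ≫ 𝟙 _ = 𝟙 _ ≫ g
      simp
    · change ((h ≫ (Q.ι.commShiftIso (1 : ℤ)).inv.app Y') ≫
        (Q.ι.commShiftIso (1 : ℤ)).hom.app Y') ≫ (𝟙 Y)⟦(1 : ℤ)⟧' = 𝟙 _ ≫ h
      refine Eq.trans ?_ (Category.id_comp h).symm
      exact (congrArg (_ ≫ ·) (Functor.map_id _ Y)).trans ((Category.comp_id _).trans
        ((Category.assoc _ _ _).trans ((congrArg (h ≫ ·) (Iso.inv_hom_id_app _ Y')).trans
          (Category.comp_id _))))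

end IsDetectedBy

end CategoryTheory.ObjectProperty

/-! ### Perfect dg modules -/

namespace DGHot

variable {A : DGAlgebra.{w, u} k}

/-- The objects of `dgHot(A)` that are zero or isomorphic to `L̂` for a simple right
`A^0`-module `L`. -/
def simples (hA : A.ZeroDiff) : ObjectProperty (DGHot A) := fun X =>
  IsZero X ∨ ∃ (L : Type u) (_ : AddCommGroup L) (_ : Module (A.gr 0)ᵐᵒᵖ L)
    (_ : IsSimpleModule (A.gr 0)ᵐᵒᵖ L), Nonempty (X ≅ ⟨DGMod.hat L hA⟩)

theorem simples_hat (hA : A.ZeroDiff) (L : Type u) [AddCommGroup L] [Module (A.gr 0)ᵐᵒᵖ L]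
    [IsSimpleModule (A.gr 0)ᵐᵒᵖ L] : simples hA ⟨DGMod.hat L hA⟩ :=
  Or.inr ⟨L, _, _, ‹_›, ⟨Iso.refl _⟩⟩

section

variable (hA : A.ZeroDiff) {L L₁ : Type u} [AddCommGroup L] [Module (A.gr 0)ᵐᵒᵖ L]
  [AddCommGroup L₁] [Module (A.gr 0)ᵐᵒᵖ L₁]

/-- The isomorphism `L̂ ≅ L̂₁` induced by an isomorphism `L ≅ L₁`. -/
def hatIso (e : L ≃ₗ[(A.gr 0)ᵐᵒᵖ] L₁) :
    (⟨DGMod.hat L hA⟩ : DGHot A) ≅ ⟨DGMod.hat L₁ hA⟩ where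
  hom := mk (DGMod.hatMap hA e.toLinearMap)
  inv := mk (DGMod.hatMap hA e.symm.toLinearMap)
  hom_inv_id := by rw [mk_comp, DGMod.hatMap_comp, mk_id, LinearEquiv.symm_comp, DGMod.hatMap_id]
  inv_hom_id := by rw [mk_comp, DGMod.hatMap_comp, mk_id, LinearEquiv.comp_symm, DGMod.hatMap_id]

theorem isIso_of_isSimpleModule [IsSimpleModule (A.gr 0)ᵐᵒᵖ L] [IsSimpleModule (A.gr 0)ᵐᵒᵖ L₁]
    (f : (⟨DGMod.hat L hA⟩ : DGHot A) ⟶ ⟨DGMod.hat L₁ hA⟩) (hf : f ≠ 0) : IsIso f := by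
  obtain ⟨f, rfl⟩ := mk_surj f
  obtain ⟨g, rfl⟩ := DGMod.hatMap_surjective hA f
  have hg : g ≠ 0 := by
    rintro rfl
    exact hf (by rw [DGMod.hatMap_zero, mk_zero])
  exact (hatIso hA (LinearEquiv.ofBijective g (LinearMap.bijective_of_ne_zero hg))).isIso_hom

theorem isZero_hat [Subsingleton L] : IsZero (⟨DGMod.hat L hA⟩ : DGHot A) := by
  rw [IsZero.iff_id_eq_zero, mk_id, mk_zero, ← DGMod.hatMap_id, ← DGMod.hatMap_zero,
    Subsingleton.elim (LinearMap.id : L →ₗ[(A.gr 0)ᵐᵒᵖ] L) 0]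

/-- The dg module `A` is isomorphic to `L̂` for `L = A^0`. -/
def selfIso : (⟨DGMod.self A⟩ : DGHot A) ≅ ⟨DGMod.hat (A.gr 0)ᵐᵒᵖ hA⟩ where
  hom := mk
    { lin :=
        { toFun := fun a : A => DGMod.hatMk hA a (1 : (A.gr 0)ᵐᵒᵖ)
          map_add' := fun a b => DGMod.hatMk_add_left hA a b _
          map_smul' := fun _ _ => rfl }
      map_mem := fun ha => DGMod.hatMk_mem hA ha _
      comm := fun _ => rfl }
  inv := mk (DGMod.hatLift hA (M := DGMod.self A)
    { toFun := fun s : (A.gr 0)ᵐᵒᵖ => ((s.unop : A.gr 0) : A)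
      map_zero' := rfl
      map_add' := fun _ _ => rfl }
    (fun s => s.unop.2) (fun s => hA _ s.unop.2) (fun _ _ => rfl))
  hom_inv_id := mk_eq_of_lin fun a => one_mul (M := (A : Type u)) a
  inv_hom_id := congrArg mk (DGMod.hat_hom_ext hA fun s => by
    change DGMod.hatMk hA (((s.unop : A.gr 0) : A) * 1) (1 : (A.gr 0)ᵐᵒᵖ) = DGMod.hatMk hA 1 s
    rw [DGMod.hatMk_mul]
    exact congrArg (DGMod.hatMk hA 1) (mul_one s))

end

theorem barVanish_of_isZero {X : DGHot A} (hX : IsZero X) (i : ℤ) : barVanish A i X := by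
  intro x hx hdx
  rw [IsZero.iff_id_eq_zero] at hX
  obtain ⟨s, hs₁, hs₂⟩ := (mk_eq_iff (DGMod.Hom.id X.as) 0).1 hX
  refine ⟨s x, hs₁ i x hx, ?_⟩
  have h : x = X.as.d (s x) + s (X.as.d x) := by simpa using hs₂ x
  rw [sub_eq_iff_eq_add'.2 h]
  exact DGMod.map_mulPosGrp s hdx

/-! ### The modules `L̂` as a simple-minded class, and the words they generate. -/

section

variable (hP : A.IsPositive) (hA : A.ZeroDiff)
include hP

theorem simples_isSimpleMinded : (simples hA).IsSimpleMinded where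
  of_iso {X Y} e h := by
    rcases h with h | ⟨L, _, _, hL, ⟨e'⟩⟩
    · exact Or.inl (h.of_iso e.symm)
    · exact Or.inr ⟨L, _, _, hL, ⟨e.symm ≪≫ e'⟩⟩
  zero_mem h := Or.inl h
  hom_eq_zero {X Y} f n hn hX hY := by
    -- It is `Y⟦n⟧` that is zero or some `L̂₁`, so `f` is compared after shifting with a map `L̂⟦n⟧
    -- ⟶ L̂₁`.
    apply (shiftFunctor (DGHot A) n).map_injective
    rw [Functor.map_zero]
    rcases hX with hX | ⟨L, _, _, _, ⟨e⟩⟩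
    · exact ((shiftFunctor (DGHot A) n).map_isZero hX).eq_of_src _ _
    rcases hY with hY | ⟨L₁, _, _, _, ⟨e'⟩⟩
    · exact hY.eq_of_tgt _ _
    have h : e.inv⟦n⟧' ≫ f⟦n⟧' ≫ e'.hom = 0 := by
      obtain ⟨g, hg⟩ := mk_surj (e.inv⟦n⟧' ≫ f⟦n⟧' ≫ e'.hom)
      rw [← hg, DGMod.hom_shift_hat_eq_zero hA hP hn g]
      rfl
    rw [← cancel_epi (e.inv⟦n⟧'), ← cancel_mono e'.hom, Category.assoc, h, comp_zero, zero_comp]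
  isIso {X Y} f hX hY hf := by
    rcases hX with hX | ⟨L, _, _, _, ⟨e⟩⟩
    · exact (hf (hX.eq_of_src _ _)).elim
    rcases hY with hY | ⟨L₁, _, _, _, ⟨e'⟩⟩
    · exact (hf (hY.eq_of_tgt _ _)).elim
    have : IsIso (e.inv ≫ f ≫ e'.hom) := isIso_of_isSimpleModule hA _ fun h => hf (by
      rw [← cancel_epi e.inv, ← cancel_mono e'.hom, Category.assoc, h, comp_zero, zero_comp])
    rw [show f = e.hom ≫ (e.inv ≫ f ≫ e'.hom) ≫ e'.inv by simp]
    infer_instance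

theorem simples_isDetectedBy : (simples hA).IsDetectedBy (barVanish A) where
  iso _ := inferInstance
  shift_iff := barVanish_shift
  ext₂ := barVanish_ext
  of_ne {i X} hi h := by
    rcases h with h | ⟨L, _, _, _, ⟨e⟩⟩
    · exact barVanish_of_isZero h i
    · exact (barVanish A i).prop_of_iso e.symm (DGMod.barVanish_hat hA hP hi)
  isZero {X} h h0 := by
    rcases h with h | ⟨L, _, _, _, ⟨e⟩⟩
    · exact h
    · have := DGMod.subsingleton_of_barVanish_hat (L := L) hA hP ((barVanish A 0).prop_of_iso e h0)
      exact (isZero_hat hA).of_iso e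

theorem dgPrae_eq_words : dgPrae hA = (simples hA).words := by
  have := simples_isSimpleMinded hP hA
  refine le_antisymm (fun X h => h _ inferInstance inferInstance fun L _ _ _ =>
    (simples hA).le_words _ (simples_hat hA L)) fun X hX Q _ _ hQ => ?_
  refine (simples hA).words_le ?_ X hX
  rintro Y (hY | ⟨L, _, _, _, ⟨e⟩⟩)
  · exact Q.prop_of_isZero hY
  · exact Q.prop_of_iso e.symm (hQ L)

variable [IsSemisimpleRing (A.gr 0)]

/-- Induction along a composition series. Each step splits by semisimplicity, and additivity of `L ↦
L̂` turns the splitting into a biproduct, avoiding exactness of the functor. -/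
theorem words_hat {L : Type u} [AddCommGroup L] [Module (A.gr 0)ᵐᵒᵖ L]
    (hL : IsFiniteLength (A.gr 0)ᵐᵒᵖ L) : (simples hA).words ⟨DGMod.hat L hA⟩ := by
  have := simples_isSimpleMinded hP hA
  induction hL with
  | of_subsingleton => exact ⟨[], isZero_hat hA⟩
  | @of_simple_quotient L _ _ N _ _ ih =>
    have := Module.projective_of_isSemisimpleRing (A.gr 0)ᵐᵒᵖ (L ⧸ N)
    obtain ⟨s, hs⟩ := Module.projective_lifting_property N.mkQ LinearMap.id N.mkQ_surjective
    have hs' : ∀ y, N.mkQ (s y) = y := fun y => LinearMap.congr_fun hs y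
    let p : L →ₗ[(A.gr 0)ᵐᵒᵖ] N := (LinearMap.id - s.comp N.mkQ).codRestrict N fun x => by
      refine (Submodule.Quotient.mk_eq_zero N).1 ?_
      change N.mkQ (x - s (N.mkQ x)) = 0
      rw [map_sub, hs', sub_self]
    have hp : ∀ x, (p x : L) = x - s (N.mkQ x) := fun _ => rfl
    let e : (⟨DGMod.hat L hA⟩ : DGHot A) ≅ ⟨DGMod.hat N hA⟩ ⊞ ⟨DGMod.hat (L ⧸ N) hA⟩ :=
      { hom := biprod.lift (mk (DGMod.hatMap hA p)) (mk (DGMod.hatMap hA N.mkQ))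
        inv := biprod.desc (mk (DGMod.hatMap hA N.subtype)) (mk (DGMod.hatMap hA s))
        hom_inv_id := by
          rw [biprod.lift_desc, mk_comp, mk_comp, DGMod.hatMap_comp, DGMod.hatMap_comp, mk_add,
            ← DGMod.hatMap_add, mk_id, ← DGMod.hatMap_id]
          congr 2
          ext x
          simp [hp]
        inv_hom_id := by
          ext
          · simp only [biprod.inl_desc_assoc, Category.assoc, biprod.lift_fst, Category.comp_id,
              BinaryBicone.inl_fst]
            rw [mk_comp, DGMod.hatMap_comp, mk_id, ← DGMod.hatMap_id]
            congr 2
            ext x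
            have hx : N.mkQ x = 0 := (Submodule.Quotient.mk_eq_zero N).2 x.2
            rw [LinearMap.comp_apply, hp, N.subtype_apply, hx, map_zero, sub_zero]
            rfl
          · simp only [biprod.inl_desc_assoc, Category.assoc, biprod.lift_snd, Category.comp_id,
              BinaryBicone.inl_snd]
            rw [mk_comp, DGMod.hatMap_comp, mk_zero, ← DGMod.hatMap_zero]
            congr 2
            ext x
            simp
          · simp only [biprod.inr_desc_assoc, Category.assoc, biprod.lift_fst, Category.comp_id,
              BinaryBicone.inr_fst]
            rw [mk_comp, DGMod.hatMap_comp, mk_zero, ← DGMod.hatMap_zero]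
            congr 2
            refine LinearMap.ext fun x => Subtype.ext ?_
            rw [LinearMap.comp_apply, hp, hs', sub_self]
            rfl
          · simp only [biprod.inr_desc_assoc, Category.assoc, biprod.lift_snd, Category.comp_id,
              BinaryBicone.inr_snd]
            rw [mk_comp, DGMod.hatMap_comp, mk_id, ← DGMod.hatMap_id, hs] }
    exact (simples hA).words.prop_of_iso e.symm
      ((simples hA).words.ext_of_isTriangulatedClosed₂ _
        (binaryBiproductTriangle_distinguished _ _) ih
        ((simples hA).le_words _ (simples_hat hA _)))

theorem words_self : (simples hA).words ⟨DGMod.self A⟩ :=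
  (simples hA).words.prop_of_iso (selfIso hA).symm
    (words_hat hP hA (isFiniteLength_iff_isNoetherian_isArtinian.2 ⟨inferInstance, inferInstance⟩))

omit hP in
-- A simple module is a cyclic quotient of `A^0`; it is projective, so the quotient map splits, and
-- `L ↦ L̂` preserves the splitting.
theorem exists_retract_self (L : Type u) [AddCommGroup L] [Module (A.gr 0)ᵐᵒᵖ L]
    [IsSimpleModule (A.gr 0)ᵐᵒᵖ L] :
    Nonempty (Retract (⟨DGMod.hat L hA⟩ : DGHot A) ⟨DGMod.self A⟩) := by
  have := IsSimpleModule.nontrivial (A.gr 0)ᵐᵒᵖ L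
  obtain ⟨l, hl⟩ := exists_ne (0 : L)
  have := Module.projective_of_isSemisimpleRing (A.gr 0)ᵐᵒᵖ L
  obtain ⟨s, hs⟩ := Module.projective_lifting_property (LinearMap.toSpanSingleton (A.gr 0)ᵐᵒᵖ L l)
    LinearMap.id (IsSimpleModule.toSpanSingleton_surjective _ hl)
  exact ⟨⟨mk (DGMod.hatMap hA s) ≫ (selfIso hA).inv,
    (selfIso hA).hom ≫ mk (DGMod.hatMap hA (LinearMap.toSpanSingleton (A.gr 0)ᵐᵒᵖ L l)), by
      rw [Category.assoc, Iso.inv_hom_id_assoc, mk_comp, DGMod.hatMap_comp, hs, DGMod.hatMap_id,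
        mk_id]⟩⟩

/-- Closure of `words` under retracts is indispensable here: it gives the inclusion of `dgPer`. The
other inclusion only needs that each `L̂` is a retract of `A`. -/
theorem dgPer_eq_words : dgPer A = (simples hA).words := by
  have := simples_isSimpleMinded hP hA
  refine le_antisymm (fun X h => h _ inferInstance inferInstance (words_self hP hA))
    fun X hX Q _ _ hQ => ?_
  refine (simples hA).words_le ?_ X hX
  rintro Y (hY | ⟨L, _, _, _, ⟨e⟩⟩)
  · exact Q.prop_of_isZero hY
  · obtain ⟨r⟩ := exists_retract_self hA L
    exact Q.prop_of_iso e.symm (Q.prop_of_retract r hQ)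

end

theorem dgPerSupp_iff (hP : A.IsPositive) (I : Set ℤ) (X : (dgPer A).FullSubcategory) :
    dgPerSupp hP I X ↔ ∀ i, i ∉ I → barVanish A i X.obj :=
  ⟨fun h i hi => (DGMod.notMem_suppH_bar_iff hP _ i).1 fun hi' => hi (h hi'),
    fun h i hi => by_contra fun hi' => (DGMod.notMem_suppH_bar_iff hP _ i).2 (h i hi') hi⟩

end DGHot

end

theorem theorem5p2 {k : Type w} [CommRing k] (A : DGAlgebra.{w, u} k)
    (P1 : A.IsPositive) (P2 : IsSemisimpleRing (A.gr 0)) (P3 : A.ZeroDiff) :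
    DGHot.dgPrae P3 = DGHot.dgPer A ∧
    ∃ t : Triangulated.TStructure (DGHot.dgPer A).FullSubcategory,
      (∀ n : ℤ, t.le n = DGHot.dgPerSupp P1 (Set.Iic n)) ∧
      (∀ n : ℤ, t.ge n = DGHot.dgPerSupp P1 (Set.Ici n)) ∧
      IsBoundedTStructure t ∧ IsNondegenerateTStructure t := by
  have := DGHot.simples_isSimpleMinded P1 P3
  have hZ := DGHot.simples_isDetectedBy P1 P3
  have hPer := DGHot.dgPer_eq_words P1 P3
  have hX : ∀ X : (DGHot.dgPer A).FullSubcategory, (DGHot.simples P3).words X.obj := fun X =>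
    hPer ▸ X.property
  have hzero : ∀ X : (DGHot.dgPer A).FullSubcategory, (∀ i, DGHot.barVanish A i X.obj) →
      IsZero X := fun X h => by
    have := hZ.isZero_of_words (hX X) h
    rw [IsZero.iff_id_eq_zero] at this ⊢
    exact (DGHot.dgPer A).ι.map_injective this
  refine ⟨(DGHot.dgPrae_eq_words P1 P3).trans hPer.symm, hZ.tStructure _ hPer, fun n => ?_,
    fun n => ?_, fun X => ?_, fun X h => ?_, fun X h => ?_⟩
  · ext X
    rw [DGHot.dgPerSupp_iff]
    simp only [Set.mem_Iic, not_le]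
    rfl
  · ext X
    rw [DGHot.dgPerSupp_iff]
    simp only [Set.mem_Ici, not_le]
    rfl
  · exact hZ.exists_bounds (hX X)
  -- Lying in the half `≤ i - 1` is what forces vanishing in degree `i`; dually `≥ i + 1` is used
  -- below.
  · exact hzero X fun i => h (i - 1) i (by omega)
  · exact hzero X fun i => h (i + 1) i (by omega)
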